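/- Let $n\in\mathbb N$, $T>0$, and consider a third order operator on $[0,T]\times\mathbb R^n$ with symbol $\tau^3+\sum_{j\le 2}\sum_{|\alpha|\le 3-j}a_{j,\alpha}(t)\tau^j\xi^\alpha$, and put $$L(t,\tau,\xi)=\tau^3+\sum_{j\le 2,\ j+|\alpha|=3}a_{j,\alpha}(t)\tau^j\xi^\alpha,\qquad M(t,\tau,\xi)=\sum_{j+|\alpha|=2}a_{j,\alpha}(t)\tau^j\xi^\alpha ,$$ where the (complex-valued) coefficients of $L$ and $M$ are real-analytic in a neighbourhood of $[0,T]$. Assume that for all $(t,\xi)\in[0,T]\times\mathbb R^n$ the polynomial $L(t,\cdot,\xi)$ has only real roots $\tau_1(t,\xi),\tau_2(t,\xi),\tau_3(t,\xi)$, listed with multiplicity but not necessarily in increasing order. Set $$\check M=M-\tfrac12\partial_t\partial_\tau L,\qquad \Delta_L^{(1)}=(\tau_1-\tau_2)^2+(\tau_2-\tau_3)^2+(\tau_3-\tau_1)^2,\qquad \mathcal L=L-\partial_\tau^2L ,$$ and let $\lambda_1,\lambda_2,\lambda_3$ be the roots in $\tau$ of $\mathcal L(t,\tau,\xi)$. Condition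 (E-Mcl) is the following: for every $R>0$ there is $C>0$ such that for all $\xi\in\mathbb R^n$ with $|\xi|\ge R$ $$\int_0^T\ \sum_{(j,k,l)\in\{(1,2,3),(2,3,1),(3,1,2)\}}\frac{|\check M(t,\lambda_j(t,\xi),\xi)|}{|\lambda_j(t,\xi)-\lambda_k(t,\xi)|\,|\lambda_j(t,\xi)-\lambda_l(t,\xi)|}\,dt\ \le\ C\log(1+|\xi|),$$ the integrand being integrable. Suppose that $\tau_1\equiv\tau_2$ and $\tau_3\not\equiv\tau_1$ on $[0,T]\times\mathbb R^n$. Consider the conditions (a) $\check M(t,\tau_1(t,\xi),\xi)=0$ for all $(t,\xi)\in[0,T]\times\mathbb R^n$; (b) with $Q(t,\tau,\xi)=\check M(t,\tau,\xi)/(\tau-\tau_1(t,\xi))$ (quotient of polynomials in $\tau$), there is $C>0$ such that, for $j=1,3$, $$|Q(t,\tau_j(t,\xi),\xi)|\le C\Bigl(\sqrt{\Delta_L^{(1)}(t,\xi)}+\bigl|\partial_t\sqrt{\Delta_L^{(1)}(t,\xi)}\bigr|\Bigr)$$ at all $(t,\xi)\in[0,T]\times\mathbb R^n$ at which the derivative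 exists (one-sided for $t=0$ and $t=T$). If (a) and (b) hold, then (E-Mcl) holds. If $n=1$, then conversely (E-Mcl) implies (a) and (b). -/

import Mathlib

open Polynomial Set MeasureTheory

namespace ThirdOrder

noncomputable section

/-- The frequency space `ℝⁿ` with its Euclidean norm. -/
abbrev Freq (n : ℕ) : Type := EuclideanSpace ℝ (Fin n)

/-- Coefficients `a j α t` of the operator
`∂ₜ³ + ∑_{j ≤ 2} ∑_{|α| ≤ 3 - j} a j α (t) ∂ₜ^j ∂ₓ^α`; only the values with `j ≤ 2` are used. -/
abbrev Coeffs (n : ℕ) : Type := ℕ → (Fin n → ℕ) → ℝ → ℂ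

/-- `∑_{j + |α| = m, j ≤ 2} a j α (t) τ^j ξ^α`, as a polynomial in `τ`. -/
def homPart {n : ℕ} (a : Coeffs n) (m : ℕ) (t : ℝ) (ξ : Freq n) : ℂ[X] :=
  ∑ p ∈ (Finset.HasAntidiagonal.antidiagonal m).filter (fun p => p.1 < 3),
    ∑ α ∈ Finset.piAntidiag (Finset.univ : Finset (Fin n)) p.2,
      C (a p.1 α t * ∏ i, (ξ i : ℂ) ^ α i) * X ^ p.1

/-- The principal symbol `L(t,τ,ξ)`, as a polynomial in `τ`. -/
def symL {n : ℕ} (a : Coeffs n) (t : ℝ) (ξ : Freq n) : ℂ[X] :=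
  X ^ 3 + homPart a 3 t ξ

/-- The symbol `M(t,τ,ξ)` of the second order terms, as a polynomial in `τ`. -/
def symM {n : ℕ} (a : Coeffs n) (t : ℝ) (ξ : Freq n) : ℂ[X] :=
  homPart a 2 t ξ

/-- `∂ₜ L(t,τ,ξ)`, as a polynomial in `τ`: the coefficients are differentiated in `t`
(the leading coefficient of `L` is constant). -/
def symDtL {n : ℕ} (a : Coeffs n) (t : ℝ) (ξ : Freq n) : ℂ[X] :=
  homPart (fun j α => deriv (a j α)) 3 t ξ

/-- `M̌ = M - (1/2) ∂ₜ ∂_τ L`, as a polynomial in `τ`. -/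
def symMcheck {n : ℕ} (a : Coeffs n) (t : ℝ) (ξ : Freq n) : ℂ[X] :=
  symM a t ξ - C (1 / 2) * derivative (symDtL a t ξ)

/-- The auxiliary polynomial `𝓛 = L - ∂_τ² L`. -/
def auxL {n : ℕ} (a : Coeffs n) (t : ℝ) (ξ : Freq n) : ℂ[X] :=
  symL a t ξ - derivative (derivative (symL a t ξ))

/-- `r 0, r 1, r 2` are the roots of the monic cubic `P`, repeated according to multiplicity. -/
def IsRootList (P : ℂ[X]) (r : Fin 3 → ℂ) : Prop :=
  P = ∏ j, (X - C (r j))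

/-- `Δ_L^{(1)}`, the sum of the squares of the differences of the roots. -/
def disc1 {n : ℕ} (τ : Fin 3 → ℝ → Freq n → ℝ) (t : ℝ) (ξ : Freq n) : ℝ :=
  (τ 0 t ξ - τ 1 t ξ) ^ 2 + (τ 1 t ξ - τ 2 t ξ) ^ 2 + (τ 2 t ξ - τ 0 t ξ) ^ 2

/-- The logarithmic condition `∫₀ᵀ |f(t,ξ)| dt ≲ log (1 + |ξ|)`, uniformly for `ξ` away from `0`. -/
def LogCondition {n : ℕ} (T : ℝ) (f : ℝ → Freq n → ℝ) : Prop :=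
  ∀ R : ℝ, 0 < R → ∃ K : ℝ, 0 < K ∧ ∀ ξ : Freq n, R ≤ ‖ξ‖ →
    IntervalIntegrable (fun t => f t ξ) volume 0 T ∧
      ∫ t in (0 : ℝ)..T, |f t ξ| ≤ K * Real.log (1 + ‖ξ‖)

/-- The Levi condition on the second order terms: the logarithmic condition for
`∑_{(j,k,l)} |M̌(λ_j)| / (|λ_j - λ_k| |λ_j - λ_l|)`, where `(j,k,l)` runs through the cyclic
permutations (indices in `Fin 3` are added modulo `3`) and `lam` lists the roots of `𝓛`. -/
def LeviM {n : ℕ} (T : ℝ) (a : Coeffs n) (lam : Fin 3 → ℝ → Freq n → ℂ) : Prop :=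
  LogCondition T fun t ξ => ∑ j : Fin 3,
    ‖(symMcheck a t ξ).eval (lam j t ξ)‖ /
      (‖lam j t ξ - lam (j + 1) t ξ‖ * ‖lam j t ξ - lam (j + 2) t ξ‖)

/-- `M̌(t, τ₁(t,ξ), ξ) = 0` for all `t ∈ [0,T]` and all `ξ`. -/
def McheckVanishes {n : ℕ} (T : ℝ) (a : Coeffs n) (τ : Fin 3 → ℝ → Freq n → ℝ) : Prop :=
  ∀ t ∈ Icc 0 T, ∀ ξ : Freq n, (symMcheck a t ξ).eval (τ 0 t ξ : ℂ) = 0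

/-- The quotient `Q = M̌ / (τ - τ₁)` of polynomials in `τ` (exact when `M̌(τ₁) = 0`). -/
def quotQ {n : ℕ} (a : Coeffs n) (τ : Fin 3 → ℝ → Freq n → ℝ) (t : ℝ) (ξ : Freq n) : ℂ[X] :=
  symMcheck a t ξ /ₘ (X - C (τ 0 t ξ : ℂ))

/-- `|Q(τ_j)| ≲ √Δ_L^{(1)} + |∂ₜ √Δ_L^{(1)}|` on `[0,T] × ℝⁿ` for `j = 1, 3`, at every point where
the derivative `d` on the right exists (one-sided at the ends of `[0,T]`). -/
def QBound {n : ℕ} (T : ℝ) (a : Coeffs n) (τ : Fin 3 → ℝ → Freq n → ℝ) : Prop :=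
  ∃ K : ℝ, 0 < K ∧ ∀ j : Fin 3, j = 0 ∨ j = 2 → ∀ t ∈ Icc 0 T, ∀ ξ : Freq n, ∀ d : ℝ,
    HasDerivWithinAt (fun s => √(disc1 τ s ξ)) d (Icc 0 T) t →
      ‖(quotQ a τ t ξ).eval (τ j t ξ : ℂ)‖ ≤ K * (√(disc1 τ t ξ) + |d|)

end

end ThirdOrder

namespace ThirdOrder

open Filter Topology

/-- The coefficient form `∑_{|α| = k} a j α t ξ^α`. -/
noncomputable def coeffForm {n : ℕ} (a : Coeffs n) (j k : ℕ) (t : ℝ) (ξ : Freq n) : ℂ :=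
  ∑ α ∈ Finset.piAntidiag (Finset.univ : Finset (Fin n)) k, a j α t * ∏ i, (ξ i : ℂ) ^ α i

section CoeffForm

variable {n : ℕ} (a : Coeffs n)

theorem homPart_three (t : ℝ) (ξ : Freq n) :
    homPart a 3 t ξ = C (coeffForm a 2 1 t ξ) * X ^ 2 + C (coeffForm a 1 2 t ξ) * X +
      C (coeffForm a 0 3 t ξ) := by
  have h : (Finset.HasAntidiagonal.antidiagonal 3).filter (fun p : ℕ × ℕ => p.1 < 3) =
      {(2, 1), (1, 2), (0, 3)} := by decide
  unfold homPart coeffForm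
  rw [h, Finset.sum_insert (by decide), Finset.sum_insert (by decide), Finset.sum_singleton]
  simp only [map_sum, Finset.sum_mul, pow_one, pow_zero, mul_one]
  ring

theorem homPart_two (t : ℝ) (ξ : Freq n) :
    homPart a 2 t ξ = C (coeffForm a 2 0 t ξ) * X ^ 2 + C (coeffForm a 1 1 t ξ) * X +
      C (coeffForm a 0 2 t ξ) := by
  have h : (Finset.HasAntidiagonal.antidiagonal 2).filter (fun p : ℕ × ℕ => p.1 < 3) =
      {(2, 0), (1, 1), (0, 2)} := by decide
  unfold homPart coeffForm
  rw [h, Finset.sum_insert (by decide), Finset.sum_insert (by decide), Finset.sum_singleton]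
  simp only [map_sum, Finset.sum_mul, pow_one, pow_zero, mul_one]
  ring

theorem coeffForm_smul (j k : ℕ) (t s : ℝ) (ξ : Freq n) :
    coeffForm a j k t (s • ξ) = (s : ℂ) ^ k * coeffForm a j k t ξ := by
  unfold coeffForm
  rw [Finset.mul_sum]
  refine Finset.sum_congr rfl fun α hα => ?_
  have hα' : ∑ i, α i = k := (Finset.mem_piAntidiag.1 hα).1
  simp only [PiLp.smul_apply, smul_eq_mul, Complex.ofReal_mul, mul_pow, Finset.prod_mul_distrib,
    Finset.prod_pow_eq_pow_sum, hα']
  ring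

theorem exists_polynomial_coeffForm_line (j k : ℕ) (t : ℝ) (ξ v : Freq n) :
    ∃ p : ℂ[X], p.natDegree ≤ k ∧ ∀ s : ℝ, coeffForm a j k t (ξ + s • v) = p.eval (s : ℂ) := by
  refine ⟨∑ α ∈ Finset.piAntidiag (Finset.univ : Finset (Fin n)) k,
    C (a j α t) * ∏ i, (C (ξ i : ℂ) + C (v i : ℂ) * X) ^ α i, ?_, fun s => ?_⟩
  · refine natDegree_sum_le_of_forall_le _ _ fun α hα => ?_
    have hα' : ∑ i, α i = k := (Finset.mem_piAntidiag.1 hα).1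
    refine (natDegree_C_mul_le _ _).trans ((natDegree_prod_le _ _).trans ?_)
    rw [← hα']
    refine Finset.sum_le_sum fun i _ => natDegree_pow_le.trans ?_
    have : (C (ξ i : ℂ) + C (v i : ℂ) * X).natDegree ≤ 1 := by
      rw [add_comm]; exact natDegree_linear_le
    simpa using Nat.mul_le_mul_left (α i) this
  · unfold coeffForm
    simp only [eval_finsetSum, eval_mul, eval_C, eval_prod, eval_pow, eval_add, eval_X]
    refine Finset.sum_congr rfl fun α _ => ?_
    simp [mul_comm]

theorem analyticOnNhd_coeffForm {s : Set ℝ} (j k : ℕ) (ξ : Freq n)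
    (h : ∀ α : Fin n → ℕ, ∑ i, α i = k → AnalyticOnNhd ℝ (a j α) s) :
    AnalyticOnNhd ℝ (fun t => coeffForm a j k t ξ) s := by
  unfold coeffForm
  refine Finset.analyticOnNhd_fun_sum _ fun α hα => ?_
  exact (h α (Finset.mem_piAntidiag.1 hα).1).mul analyticOnNhd_const

theorem deriv_coeffs_analyticOnNhd {T : ℝ}
    (ha : ∀ (j : ℕ) (α : Fin n → ℕ), j < 3 → (j + ∑ i, α i = 2 ∨ j + ∑ i, α i = 3) →
      AnalyticOnNhd ℝ (a j α) (Icc 0 T)) :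
    ∀ (j : ℕ) (α : Fin n → ℕ), j < 3 → (j + ∑ i, α i = 2 ∨ j + ∑ i, α i = 3) →
      AnalyticOnNhd ℝ (deriv (a j α)) (Icc 0 T) :=
  fun j α hj h => (ha j α hj h).deriv

/-- The coefficients of `M̌` as a polynomial in `τ`. -/
noncomputable def mcheckCoeff (a : Coeffs n) : ℕ → ℝ → Freq n → ℂ
  | 0, t, ξ => coeffForm a 0 2 t ξ - 1 / 2 * coeffForm (fun j α => deriv (a j α)) 1 2 t ξ
  | 1, t, ξ => coeffForm a 1 1 t ξ - coeffForm (fun j α => deriv (a j α)) 2 1 t ξ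
  | _, t, ξ => coeffForm a 2 0 t ξ

theorem symMcheck_eq (t : ℝ) (ξ : Freq n) :
    symMcheck a t ξ = C (mcheckCoeff a 2 t ξ) * X ^ 2 + C (mcheckCoeff a 1 t ξ) * X +
      C (mcheckCoeff a 0 t ξ) := by
  unfold symMcheck symM symDtL
  rw [homPart_three, homPart_two]
  simp only [derivative_add, derivative_mul, derivative_C, derivative_X_pow, derivative_X,
    mcheckCoeff, map_sub, map_mul]
  have h2 : (C (1 / 2 : ℂ)) * (C ((2 : ℕ) : ℂ)) = 1 := by
    rw [← C_mul]; norm_num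
  linear_combination (-(C (coeffForm (fun j α => deriv (a j α)) 2 1 t ξ) * X)) * h2

theorem mcheckCoeff_smul (k : ℕ) (hk : k ≤ 2) (t s : ℝ) (ξ : Freq n) :
    mcheckCoeff a k t (s • ξ) = (s : ℂ) ^ (2 - k) * mcheckCoeff a k t ξ := by
  interval_cases k <;> simp only [mcheckCoeff, coeffForm_smul] <;> ring

theorem analyticOnNhd_mcheckCoeff {T : ℝ}
    (ha : ∀ (j : ℕ) (α : Fin n → ℕ), j < 3 → (j + ∑ i, α i = 2 ∨ j + ∑ i, α i = 3) →
      AnalyticOnNhd ℝ (a j α) (Icc 0 T)) (k : ℕ) (hk : k ≤ 2) (ξ : Freq n) :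
    AnalyticOnNhd ℝ (fun t => mcheckCoeff a k t ξ) (Icc 0 T) := by
  have hd := deriv_coeffs_analyticOnNhd a ha
  interval_cases k <;> simp only [mcheckCoeff]
  · exact (analyticOnNhd_coeffForm a 0 2 ξ fun α h => ha 0 α (by norm_num) (by omega)).sub
      (analyticOnNhd_const.mul
        (analyticOnNhd_coeffForm _ 1 2 ξ fun α h => hd 1 α (by norm_num) (by omega)))
  · exact (analyticOnNhd_coeffForm a 1 1 ξ fun α h => ha 1 α (by norm_num) (by omega)).sub
      (analyticOnNhd_coeffForm _ 2 1 ξ fun α h => hd 2 α (by norm_num) (by omega))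
  · exact analyticOnNhd_coeffForm a 2 0 ξ fun α h => ha 2 α (by norm_num) (by omega)

/-- Vieta's formulas for a monic cubic. -/
theorem IsRootList.vieta {p q r : ℂ} {z : Fin 3 → ℂ}
    (h : IsRootList (X ^ 3 + (C p * X ^ 2 + C q * X + C r)) z) :
    z 0 + z 1 + z 2 = -p ∧ z 0 * z 1 + z 1 * z 2 + z 2 * z 0 = q ∧ z 0 * z 1 * z 2 = -r := by
  unfold IsRootList at h
  rw [Fin.prod_univ_three] at h
  have e (x : ℂ) : x ^ 3 + (p * x ^ 2 + q * x + r) = (x - z 0) * (x - z 1) * (x - z 2) := by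
    have := congrArg (eval x) h
    simpa using this
  have e0 := e 0
  have e1 := e 1
  have e2 := e (-1)
  refine ⟨?_, ?_, ?_⟩
  · linear_combination (1 / 2) * e1 + (1 / 2) * e2 - e0
  · linear_combination (-1 / 2) * e1 + (1 / 2) * e2
  · linear_combination e0

theorem symL_eq (t : ℝ) (ξ : Freq n) :
    symL a t ξ = X ^ 3 + (C (coeffForm a 2 1 t ξ) * X ^ 2 + C (coeffForm a 1 2 t ξ) * X +
      C (coeffForm a 0 3 t ξ)) := by
  rw [symL, homPart_three]

theorem auxL_eq (t : ℝ) (ξ : Freq n) :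
    auxL a t ξ = X ^ 3 + (C (coeffForm a 2 1 t ξ) * X ^ 2 + C (coeffForm a 1 2 t ξ - 6) * X +
      C (coeffForm a 0 3 t ξ - 2 * coeffForm a 2 1 t ξ)) := by
  rw [auxL, symL_eq]
  simp only [derivative_add, derivative_mul, derivative_C, derivative_X_pow, derivative_X,
    map_sub, map_mul, derivative_zero, derivative_one]
  have h6 : (C (6 : ℂ)) = 6 := rfl
  have h2 : (C (2 : ℂ)) = 2 := rfl
  simp only [h6, h2, Nat.cast_ofNat, map_ofNat]
  norm_num
  linear_combination (-3 * X) * h2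

end CoeffForm

/-- A function on the line whose square and cube are polynomials, the square being of degree at
most two, is affine. Only the midpoint identity is recorded. -/
theorem midpoint_of_sq_cube_polynomial {g : ℝ → ℝ} {q c : ℂ[X]} (hq : q.natDegree ≤ 2)
    (h2 : ∀ s : ℝ, ((g s : ℝ) : ℂ) ^ 2 = q.eval (s : ℂ))
    (h3 : ∀ s : ℝ, ((g s : ℝ) : ℂ) ^ 3 = c.eval (s : ℂ)) :
    2 * g (1 / 2) = g 0 + g 1 := by
  have hcq : c ^ 2 = q ^ 3 := by
    refine eq_of_infinite_eval_eq _ _ ((infinite_range_of_injective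
      Complex.ofReal_injective).mono ?_)
    rintro _ ⟨s, rfl⟩
    simp only [mem_ofPred_eq, eval_pow, ← h2, ← h3]
    ring
  obtain ⟨h, hh⟩ : q ∣ c := by
    refine (UniqueFactorizationMonoid.pow_dvd_pow_iff_dvd two_ne_zero).1 ⟨q, ?_⟩
    rw [hcq]; ring
  have hg : ∀ s : ℝ, q ≠ 0 → ((g s : ℝ) : ℂ) = h.eval (s : ℂ) := by
    intro s hq0
    have hhq : h ^ 2 = q := by
      have : q ^ 2 * h ^ 2 = q ^ 2 * q := by
        rw [← mul_pow, ← hh, hcq]; ring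
      exact mul_left_cancel₀ (pow_ne_zero 2 hq0) this
    by_cases h0 : g s = 0
    · have : (h.eval (s : ℂ)) ^ 2 = 0 := by
        rw [← eval_pow, hhq, ← h2, h0]; simp
      rw [h0, eq_zero_of_pow_eq_zero this]; simp
    · have h0' : ((g s : ℝ) : ℂ) ^ 2 ≠ 0 := pow_ne_zero 2 (Complex.ofReal_ne_zero.2 h0)
      apply mul_left_cancel₀ h0'
      have := h3 s
      rw [hh, eval_mul, ← h2] at this
      rw [← this]; ring
  by_cases hq0 : q = 0
  · have : ∀ s, g s = 0 := fun s => by simpa [hq0] using h2 s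
    simp [this]
  · have hdeg : h.natDegree ≤ 1 := by
      have hhq : h ^ 2 = q := by
        have : q ^ 2 * h ^ 2 = q ^ 2 * q := by
          rw [← mul_pow, ← hh, hcq]; ring
        exact mul_left_cancel₀ (pow_ne_zero 2 hq0) this
      have := natDegree_pow h 2
      rw [hhq] at this
      omega
    obtain ⟨u, v, rfl⟩ := exists_eq_X_add_C_of_natDegree_le_one hdeg
    have e (s : ℝ) := hg s hq0
    simp only [eval_add, eval_mul, eval_C, eval_X] at e
    have : ((2 * g (1 / 2) : ℝ) : ℂ) = ((g 0 + g 1 : ℝ) : ℂ) := by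
      push_cast
      rw [e 0, e 1, e (1 / 2)]
      push_cast
      ring
    exact_mod_cast this

/-- If `c ^ 2 = q ^ 3` near a point, with `c` and `q` analytic there, then `c / q` is analytic. -/
theorem analyticAt_div_of_sq_eq_cube {c q : ℝ → ℝ} {x : ℝ} (hc : AnalyticAt ℝ c x)
    (hq : AnalyticAt ℝ q x) (h : ∀ᶠ t in 𝓝 x, c t ^ 2 = q t ^ 3) :
    AnalyticAt ℝ (fun t => c t / q t) x := by
  by_cases hq0 : ∀ᶠ t in 𝓝 x, q t = 0
  · refine (analyticAt_const (v := (0 : ℝ))).congr ?_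
    filter_upwards [hq0] with t ht
    simp [ht]
  have hqT : analyticOrderAt q x ≠ ⊤ := fun h' => hq0 (analyticOrderAt_eq_top.1 h')
  have hcT : analyticOrderAt c x ≠ ⊤ := by
    intro h'
    apply hq0
    filter_upwards [h, analyticOrderAt_eq_top.1 h'] with t h1 h2
    rw [h2] at h1
    exact eq_zero_of_pow_eq_zero (n := 3) (by rw [← h1]; norm_num)
  have hord : 2 * analyticOrderNatAt c x = 3 * analyticOrderNatAt q x := by
    have h1 : analyticOrderAt (c ^ 2) x = analyticOrderAt (q ^ 3) x :=
      analyticOrderAt_congr h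
    rw [analyticOrderAt_pow hc, analyticOrderAt_pow hq, ← Nat.cast_analyticOrderNatAt hqT,
      ← Nat.cast_analyticOrderNatAt hcT] at h1
    simp only [nsmul_eq_mul] at h1
    exact_mod_cast h1
  obtain ⟨u, hu, hu0, hqu⟩ := hq.analyticOrderAt_ne_top.1 hqT
  obtain ⟨v, hv, hv0, hcv⟩ := hc.analyticOrderAt_ne_top.1 hcT
  obtain ⟨k, hk⟩ : ∃ k, analyticOrderNatAt q x = 2 * k := ⟨analyticOrderNatAt q x / 2, by omega⟩
  have hk' : analyticOrderNatAt c x = 3 * k := by omega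
  rw [hk] at hqu
  rw [hk'] at hcv
  have han : AnalyticAt ℝ (fun t => (t - x) ^ k * (v t / u t)) x :=
    ((analyticAt_id.sub analyticAt_const).pow k).mul (hv.div hu hu0)
  refine han.congr ?_
  filter_upwards [h, hqu, hcv, hu.continuousAt.eventually_ne hu0] with t h1 h2 h3 hut
  simp only [smul_eq_mul] at h2 h3
  by_cases htx : t - x = 0
  · by_cases hk0 : k = 0
    · rw [h2, h3]; simp [hk0]
    · rw [h2, h3, htx]; simp [hk0]
  · rw [h2, h3]
    field_simp
    ring

theorem abs_arsinh_le (s : ℝ) : |Real.arsinh s| ≤ Real.log (1 + 2 * |s|) := by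
  have key : ∀ s : ℝ, 0 ≤ s → Real.arsinh s ≤ Real.log (1 + 2 * s) := by
    intro s hs
    unfold Real.arsinh
    apply Real.log_le_log (by positivity)
    have : √(1 + s ^ 2) ≤ 1 + s := by
      rw [Real.sqrt_le_left (by positivity)]; nlinarith
    linarith
  rcases le_total 0 s with hs | hs
  · rw [abs_of_nonneg hs, abs_of_nonneg (Real.arsinh_nonneg_iff.2 hs)]
    exact key s hs
  · rw [abs_of_nonpos hs, abs_of_nonpos (Real.arsinh_nonpos_iff.2 hs), ← Real.arsinh_neg]
    exact key (-s) (by linarith)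

section Variation

variable {g : ℕ → ℝ → ℝ}

theorem intervalIntegral_abs_deriv_div_le_of_sign {a b B : ℝ} (hab : a ≤ b)
    (hg : ∀ k, ∀ x ∈ Icc a b, HasDerivAt (g k) (g (k + 1) x) x)
    (hB : ∀ x ∈ Icc a b, |g 0 x| ≤ B)
    (hs : (∀ x ∈ Icc a b, 0 ≤ g 1 x) ∨ ∀ x ∈ Icc a b, g 1 x ≤ 0) :
    ∫ x in a..b, |g 1 x| / √(1 + g 0 x ^ 2) ≤ 2 * Real.log (1 + 2 * B) := by
  have hc0 : ContinuousOn (g 0) (uIcc a b) := fun x hx =>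
    (hg 0 x (uIcc_of_le hab ▸ hx)).continuousAt.continuousWithinAt
  have hc1 : ContinuousOn (g 1) (uIcc a b) := fun x hx =>
    (hg 1 x (uIcc_of_le hab ▸ hx)).continuousAt.continuousWithinAt
  have hint : IntervalIntegrable (fun x => (√(1 + g 0 x ^ 2))⁻¹ * g 1 x) volume a b := by
    apply ContinuousOn.intervalIntegrable
    refine ContinuousOn.mul (ContinuousOn.inv₀ (by fun_prop) fun x _ => ?_) hc1
    positivity
  have hftc := intervalIntegral.integral_eq_sub_of_hasDerivAt
    (f := fun x => Real.arsinh (g 0 x)) (fun x hx => by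
      have := (hg 0 x (uIcc_of_le hab ▸ hx)).arsinh
      simpa using this) hint
  have hbd : ∀ x ∈ Icc a b, |Real.arsinh (g 0 x)| ≤ Real.log (1 + 2 * B) := fun x hx =>
    (abs_arsinh_le _).trans (Real.log_le_log (by positivity) (by linarith [hB x hx]))
  have ha := abs_le.1 (hbd a (left_mem_Icc.2 hab))
  have hb := abs_le.1 (hbd b (right_mem_Icc.2 hab))
  rcases hs with hs | hs
  · have : ∫ x in a..b, |g 1 x| / √(1 + g 0 x ^ 2) = ∫ x in a..b, (√(1 + g 0 x ^ 2))⁻¹ * g 1 x := by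
      refine intervalIntegral.integral_congr fun x hx => ?_
      rw [uIcc_of_le hab] at hx
      simp only [abs_of_nonneg (hs x hx)]
      ring
    rw [this, hftc]
    linarith
  · have : ∫ x in a..b, |g 1 x| / √(1 + g 0 x ^ 2) =
        -∫ x in a..b, (√(1 + g 0 x ^ 2))⁻¹ * g 1 x := by
      rw [← intervalIntegral.integral_neg]
      refine intervalIntegral.integral_congr fun x hx => ?_
      rw [uIcc_of_le hab] at hx
      simp only [abs_of_nonpos (hs x hx)]
      ring
    rw [this, hftc]
    linarith

/-- A monotone function changes sign at most once. -/
theorem exists_sign_change {f : ℝ → ℝ} {a b : ℝ} (hab : a ≤ b) (hc : ContinuousOn f (Icc a b))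
    (hf : MonotoneOn f (Icc a b)) :
    ∃ c ∈ Icc a b, (∀ x ∈ Icc a c, f x ≤ 0) ∧ (∀ x ∈ Icc c b, 0 ≤ f x) ∨
      (∀ x ∈ Icc a b, f x ≤ 0) ∨ (∀ x ∈ Icc a b, 0 ≤ f x) := by
  rcases le_total 0 (f a) with h | h
  · exact ⟨a, left_mem_Icc.2 hab, Or.inr <| Or.inr fun x hx =>
      h.trans (hf (left_mem_Icc.2 hab) hx hx.1)⟩
  rcases le_total (f b) 0 with h' | h'
  · exact ⟨a, left_mem_Icc.2 hab, Or.inr <| Or.inl fun x hx =>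
      (hf hx (right_mem_Icc.2 hab) hx.2).trans h'⟩
  obtain ⟨c, hc, hfc⟩ := intermediate_value_Icc hab hc ⟨h, h'⟩
  exact ⟨c, hc, Or.inl ⟨fun x hx => hfc ▸ hf ⟨hx.1, hx.2.trans hc.2⟩ hc hx.2,
    fun x hx => hfc ▸ hf hc ⟨hc.1.trans hx.1, hx.2⟩ hx.1⟩⟩

theorem exists_sign_split {f f' : ℝ → ℝ} {a b : ℝ} (hab : a ≤ b)
    (hf : ∀ x ∈ Icc a b, HasDerivAt f (f' x) x)
    (hs : (∀ x ∈ Icc a b, 0 ≤ f' x) ∨ ∀ x ∈ Icc a b, f' x ≤ 0) :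
    ∃ c ∈ Icc a b, ((∀ x ∈ Icc a c, 0 ≤ f x) ∨ ∀ x ∈ Icc a c, f x ≤ 0) ∧
      ((∀ x ∈ Icc c b, 0 ≤ f x) ∨ ∀ x ∈ Icc c b, f x ≤ 0) := by
  have hc : ContinuousOn f (Icc a b) := fun x hx => (hf x hx).continuousAt.continuousWithinAt
  have hsub : ∀ c ∈ Icc a b, ∀ x ∈ Icc a c, x ∈ Icc a b := fun c hc x hx =>
    ⟨hx.1, hx.2.trans hc.2⟩
  have hsub' : ∀ c ∈ Icc a b, ∀ x ∈ Icc c b, x ∈ Icc a b := fun c hc x hx =>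
    ⟨hc.1.trans hx.1, hx.2⟩
  rcases hs with hs | hs
  · have hm : MonotoneOn f (Icc a b) := by
      refine monotoneOn_of_deriv_nonneg (convex_Icc a b) hc
        (fun x hx => (hf x (interior_subset hx)).differentiableAt.differentiableWithinAt)
        fun x hx => ?_
      rw [(hf x (interior_subset hx)).deriv]
      exact hs x (interior_subset hx)
    obtain ⟨c, hcm, ⟨h1, h2⟩ | h | h⟩ := exists_sign_change hab hc hm
    · exact ⟨c, hcm, Or.inr h1, Or.inl h2⟩
    · exact ⟨c, hcm, Or.inr fun x hx => h x (hsub c hcm x hx),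
        Or.inr fun x hx => h x (hsub' c hcm x hx)⟩
    · exact ⟨c, hcm, Or.inl fun x hx => h x (hsub c hcm x hx),
        Or.inl fun x hx => h x (hsub' c hcm x hx)⟩
  · have hm : MonotoneOn (fun x => -f x) (Icc a b) := by
      have : AntitoneOn f (Icc a b) := by
        refine antitoneOn_of_deriv_nonpos (convex_Icc a b) hc
          (fun x hx => (hf x (interior_subset hx)).differentiableAt.differentiableWithinAt)
          fun x hx => ?_
        rw [(hf x (interior_subset hx)).deriv]
        exact hs x (interior_subset hx)
      exact this.neg
    obtain ⟨c, hcm, ⟨h1, h2⟩ | h | h⟩ := exists_sign_change hab hc.neg hm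
    · exact ⟨c, hcm, Or.inl fun x hx => neg_nonpos.1 (h1 x hx),
        Or.inr fun x hx => neg_nonneg.1 (h2 x hx)⟩
    · exact ⟨c, hcm, Or.inl fun x hx => neg_nonpos.1 (h x (hsub c hcm x hx)),
        Or.inl fun x hx => neg_nonpos.1 (h x (hsub' c hcm x hx))⟩
    · exact ⟨c, hcm, Or.inr fun x hx => neg_nonneg.1 (h x (hsub c hcm x hx)),
        Or.inr fun x hx => neg_nonneg.1 (h x (hsub' c hcm x hx))⟩

theorem intervalIntegrable_abs_deriv_div {a b : ℝ} (hab : a ≤ b)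
    (hg : ∀ k, ∀ x ∈ Icc a b, HasDerivAt (g k) (g (k + 1) x) x) :
    IntervalIntegrable (fun x => |g 1 x| / √(1 + g 0 x ^ 2)) volume a b := by
  have hc0 : ContinuousOn (g 0) (uIcc a b) := fun x hx =>
    (hg 0 x (uIcc_of_le hab ▸ hx)).continuousAt.continuousWithinAt
  have hc1 : ContinuousOn (g 1) (uIcc a b) := fun x hx =>
    (hg 1 x (uIcc_of_le hab ▸ hx)).continuousAt.continuousWithinAt
  apply ContinuousOn.intervalIntegrable
  refine ContinuousOn.div hc1.abs (by fun_prop) fun x _ => ?_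
  positivity

/-- If the derivative of order `m + 1` of `g 0` has constant sign on `[a, b]`, then the total
variation of `arsinh ∘ g 0` is bounded by `2 ^ (m + 1) log (1 + 2 sup |g 0|)`. -/
theorem intervalIntegral_abs_deriv_div_le {B : ℝ} (m : ℕ) : ∀ {a b : ℝ}, a ≤ b →
    (∀ k, ∀ x ∈ Icc a b, HasDerivAt (g k) (g (k + 1) x) x) →
    (∀ x ∈ Icc a b, |g 0 x| ≤ B) →
    ((∀ x ∈ Icc a b, 0 ≤ g (m + 1) x) ∨ ∀ x ∈ Icc a b, g (m + 1) x ≤ 0) →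
    ∫ x in a..b, |g 1 x| / √(1 + g 0 x ^ 2) ≤ 2 ^ (m + 1) * Real.log (1 + 2 * B) := by
  induction m with
  | zero =>
    intro a b hab hg hB hs
    simpa using intervalIntegral_abs_deriv_div_le_of_sign hab hg hB hs
  | succ m ih =>
    intro a b hab hg hB hs
    obtain ⟨c, hc, h1, h2⟩ := exists_sign_split hab (hg (m + 1)) hs
    have s1 : Icc a c ⊆ Icc a b := Icc_subset_Icc_right hc.2
    have s2 : Icc c b ⊆ Icc a b := Icc_subset_Icc_left hc.1
    have i1 := ih hc.1 (fun k x hx => hg k x (s1 hx)) (fun x hx => hB x (s1 hx)) h1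
    have i2 := ih hc.2 (fun k x hx => hg k x (s2 hx)) (fun x hx => hB x (s2 hx)) h2
    rw [← intervalIntegral.integral_add_adjacent_intervals
      (intervalIntegrable_abs_deriv_div hc.1 fun k x hx => hg k x (s1 hx))
      (intervalIntegrable_abs_deriv_div hc.2 fun k x hx => hg k x (s2 hx))]
    calc _ ≤ _ := add_le_add i1 i2
      _ = _ := by ring

end Variation

section Family

variable {n : ℕ} {T : ℝ} {d : Fin n → ℝ → ℝ}

/-- The derivative of order `k` of the linear combination `∑ i, c i * d i`. -/
noncomputable def combDeriv (d : Fin n → ℝ → ℝ) (k : ℕ) (c : Freq n) (t : ℝ) : ℝ :=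
  ∑ i, c i * iteratedDeriv k (d i) t

theorem analyticOnNhd_iteratedDeriv {f : ℝ → ℝ} {s : Set ℝ} (h : AnalyticOnNhd ℝ f s) (k : ℕ) :
    AnalyticOnNhd ℝ (iteratedDeriv k f) s := by
  rw [iteratedDeriv_eq_iterate]
  exact h.iterated_deriv k

theorem hasDerivAt_combDeriv {t : ℝ} (hd : ∀ i, AnalyticAt ℝ (d i) t) (k : ℕ) (c : Freq n) :
    HasDerivAt (combDeriv d k c) (combDeriv d (k + 1) c t) t := by
  unfold combDeriv
  refine HasDerivAt.fun_sum fun i _ => HasDerivAt.const_mul _ ?_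
  rw [iteratedDeriv_succ]
  have h : AnalyticOnNhd ℝ (d i) {t} := fun x hx => by
    rw [mem_singleton_iff.1 hx]; exact hd i
  exact (analyticOnNhd_iteratedDeriv h k t rfl).differentiableAt.hasDerivAt

theorem iteratedDeriv_comb {t : ℝ} (hd : ∀ i, AnalyticAt ℝ (d i) t) (k : ℕ) (c : Freq n) :
    iteratedDeriv k (combDeriv d 0 c) t = combDeriv d k c t := by
  unfold combDeriv
  simp only [iteratedDeriv_zero]
  have h : ∀ i ∈ Finset.univ, ContDiffAt ℝ k (fun z => c i * d i z) t := fun i _ =>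
    (analyticAt_const.mul (hd i)).contDiffAt
  rw [iteratedDeriv_fun_sum h]
  exact Finset.sum_congr rfl fun i _ => iteratedDeriv_const_mul_field _ _

theorem combDeriv_add (k : ℕ) (c c' : Freq n) (t : ℝ) :
    combDeriv d k (c + c') t = combDeriv d k c t + combDeriv d k c' t := by
  simp [combDeriv, add_mul, Finset.sum_add_distrib]

theorem combDeriv_smul (k : ℕ) (r : ℝ) (c : Freq n) (t : ℝ) :
    combDeriv d k (r • c) t = r * combDeriv d k c t := by
  simp [combDeriv, Finset.mul_sum, mul_assoc]

theorem combDeriv_succ_eq_zero (hd : ∀ i, AnalyticOnNhd ℝ (d i) (Icc 0 T)) {c : Freq n}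
    {t₀ : ℝ} (ht₀ : t₀ ∈ Icc 0 T) (h : ∀ m, combDeriv d (m + 1) c t₀ = 0) (m : ℕ) :
    ∀ t ∈ Icc 0 T, combDeriv d (m + 1) c t = 0 := by
  have hf : AnalyticOnNhd ℝ (combDeriv d 0 c) (Icc 0 T) := by
    unfold combDeriv
    simp only [iteratedDeriv_zero]
    exact Finset.analyticOnNhd_fun_sum _ fun i _ => analyticOnNhd_const.mul (hd i)
  have hev : deriv (combDeriv d 0 c) =ᶠ[𝓝 t₀] 0 := by
    change ∀ᶠ t in 𝓝 t₀, deriv (combDeriv d 0 c) t = 0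
    rw [← analyticOrderAt_eq_top (f := deriv (combDeriv d 0 c)),
      ENat.eq_top_iff_forall_ge]
    intro k
    rw [natCast_le_analyticOrderAt_iff_iteratedDeriv_eq_zero (hf t₀ ht₀).deriv]
    intro i _
    rw [← iteratedDeriv_succ', iteratedDeriv_comb (fun i => hd i t₀ ht₀)]
    exact h i
  have hev' : iteratedDeriv (m + 1) (combDeriv d 0 c) =ᶠ[𝓝 t₀] 0 := by
    rw [iteratedDeriv_succ']
    filter_upwards [hev.eventuallyEq_nhds] with t ht
    rw [ht.iteratedDeriv_eq m]
    simp
  intro t ht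
  rw [← iteratedDeriv_comb (fun i => hd i t ht)]
  exact (analyticOnNhd_iteratedDeriv hf (m + 1)).eqOn_zero_of_preconnected_of_eventuallyEq_zero
    isPreconnected_Icc ht₀ hev' ht

/-- The combinations whose derivative vanishes identically. -/
def constComb (T : ℝ) (d : Fin n → ℝ → ℝ) : Submodule ℝ (Freq n) where
  carrier := {c | ∀ m, ∀ t ∈ Icc 0 T, combDeriv d (m + 1) c t = 0}
  add_mem' {x y} hx hy m t ht := by rw [combDeriv_add, hx m t ht, hy m t ht, add_zero]
  zero_mem' m t _ := by simp [combDeriv]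
  smul_mem' r x hx m t ht := by rw [combDeriv_smul, hx m t ht, mul_zero]

/-- Uniformly on the unit sphere of the orthogonal complement of `constComb`, some derivative of
bounded order does not vanish on an interval of fixed length around a given point. -/
theorem exists_uniform_nonvanishing (hd : ∀ i, AnalyticOnNhd ℝ (d i) (Icc 0 T)) :
    ∃ M : ℕ, ∃ ε > 0, ∀ c ∈ (constComb T d)ᗮ, ‖c‖ = 1 → ∀ t ∈ Icc 0 T, ∃ m ≤ M,
      ∀ t' ∈ Icc 0 T, |t' - t| < ε → combDeriv d (m + 1) c t' ≠ 0 := by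
  let S : Set (Freq n) := ((constComb T d)ᗮ : Set (Freq n)) ∩ Metric.sphere 0 1
  have hS : IsCompact S :=
    (isCompact_sphere 0 1).inter_left (Submodule.isClosed_orthogonal _)
  have : CompactSpace S := isCompact_iff_compactSpace.1 hS
  let V : ℕ → Set (S × Icc (0 : ℝ) T) := fun m => {x | combDeriv d (m + 1) x.1 x.2 ≠ 0}
  have hV : ∀ m, IsOpen (V m) := by
    intro m
    refine isOpen_ne_fun ?_ continuous_const
    unfold combDeriv
    refine continuous_finsetSum _ fun i _ => ?_
    have h1 : Continuous fun x : S × Icc (0 : ℝ) T => (x.1 : Freq n) i := by fun_prop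
    have h2 : Continuous fun x : S × Icc (0 : ℝ) T => iteratedDeriv (m + 1) (d i) x.2 :=
      ((analyticOnNhd_iteratedDeriv (hd i) (m + 1)).continuousOn.domRestrict).comp continuous_snd
    exact h1.mul h2
  have hcov : (univ : Set (S × Icc (0 : ℝ) T)) ⊆ ⋃ m, V m := by
    rintro ⟨⟨c, hc, hc1⟩, ⟨t, ht⟩⟩ -
    rw [mem_iUnion]
    by_contra! hcon
    have hc0 : c ∈ constComb T d := fun m t' ht' =>
      combDeriv_succ_eq_zero hd ht (fun m => by simpa [V] using hcon m) m t' ht'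
    have : c = 0 := by
      have := (Submodule.mem_orthogonal _ _).1 hc c hc0
      simpa using this
    simp [this] at hc1
  obtain ⟨F, hF⟩ := isCompact_univ.elim_finite_subcover V hV hcov
  obtain ⟨ε, hε, h⟩ := lebesgue_number_lemma_of_metric (c := fun m : F => V m) isCompact_univ
    (fun m => hV m) (by simpa [iUnion_subtype] using hF)
  refine ⟨F.sup id, ε, hε, fun c hc hc1 t ht => ?_⟩
  obtain ⟨m, hm⟩ := h (⟨⟨c, hc, by simpa using hc1⟩, ⟨t, ht⟩⟩ : (S × Icc (0 : ℝ) T)) (mem_univ _)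
  refine ⟨m, Finset.le_sup (f := id) m.2, fun t' ht' htt => ?_⟩
  have : ((⟨⟨c, hc, by simpa using hc1⟩, ⟨t', ht'⟩⟩ : (S × Icc (0 : ℝ) T))) ∈ V m := by
    apply hm
    rw [Metric.mem_ball, Prod.dist_eq]
    simpa [Subtype.dist_eq, Real.dist_eq, hε] using htt
  exact this

theorem constant_sign_of_ne_zero {f : ℝ → ℝ} {a b : ℝ} (hc : ContinuousOn f (Icc a b))
    (h0 : ∀ x ∈ Icc a b, f x ≠ 0) :
    (∀ x ∈ Icc a b, 0 ≤ f x) ∨ ∀ x ∈ Icc a b, f x ≤ 0 := by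
  by_contra! hcon
  obtain ⟨⟨x, hx, hfx⟩, y, hy, hfy⟩ := hcon
  obtain ⟨z, hz, hfz⟩ := isPreconnected_Icc.intermediate_value hx hy hc ⟨hfx.le, hfy.le⟩
  exact h0 z hz hfz

/-- Uniform bound for the variation of `arsinh` of linear combinations of analytic functions. -/
theorem exists_uniform_variation_bound (hT : 0 < T)
    (hd : ∀ i, AnalyticOnNhd ℝ (d i) (Icc 0 T)) :
    ∃ N : ℝ, 0 ≤ N ∧ ∀ (c : Freq n) (B : ℝ), (∀ t ∈ Icc 0 T, |combDeriv d 0 c t| ≤ B) →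
      ∫ t in (0 : ℝ)..T, |combDeriv d 1 c t| / √(1 + combDeriv d 0 c t ^ 2) ≤
        N * Real.log (1 + 2 * B) := by
  obtain ⟨M, ε, hε, h⟩ := exists_uniform_nonvanishing hd
  obtain ⟨N, hN⟩ := exists_nat_gt (T / ε)
  have hN0 : (0 : ℝ) < N := lt_of_le_of_lt (by positivity) hN
  have hNT : T / N < ε := by
    rw [div_lt_iff₀ hε] at hN
    rw [div_lt_iff₀ hN0]; linarith
  refine ⟨N * 2 ^ (M + 1), by positivity, fun c B hB => ?_⟩
  have hB0 : 0 ≤ B := (abs_nonneg _).trans (hB 0 (left_mem_Icc.2 hT.le))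
  have hlog : 0 ≤ Real.log (1 + 2 * B) := Real.log_nonneg (by linarith)
  have hder : ∀ k, ∀ x ∈ Icc 0 T, HasDerivAt (combDeriv d k c) (combDeriv d (k + 1) c x) x :=
    fun k x hx => hasDerivAt_combDeriv (fun i => hd i x hx) k c
  let u : ℕ → ℝ := fun k => k * (T / N)
  have hstep : ∀ k, u (k + 1) = u k + T / N := fun k => by simp only [u]; push_cast; ring
  have hTN : 0 < T / N := by positivity
  have hu0 : u 0 = 0 := by simp [u]
  have huN : u N = T := by simp only [u]; field_simp
  have humono : Monotone u := monotone_nat_of_le_succ fun k => by rw [hstep]; linarith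
  have hsub : ∀ k < N, Icc (u k) (u (k + 1)) ⊆ Icc 0 T := fun k hk =>
    Icc_subset_Icc (hu0 ▸ humono k.zero_le) (huN ▸ humono (Nat.succ_le_of_lt hk))
  have hle : ∀ k, u k ≤ u (k + 1) := fun k => humono k.le_succ
  have hpiece : ∀ k < N, ∫ t in (u k)..(u (k + 1)),
      |combDeriv d 1 c t| / √(1 + combDeriv d 0 c t ^ 2) ≤ 2 ^ (M + 1) * Real.log (1 + 2 * B) := by
    intro k hk
    obtain ⟨y, hy, z, hz, rfl⟩ := (constComb T d).exists_add_mem_mem_orthogonal c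
    have hyz : ∀ m, ∀ t ∈ Icc 0 T, combDeriv d (m + 1) (y + z) t = combDeriv d (m + 1) z t :=
      fun m t ht => by rw [combDeriv_add, hy m t ht, zero_add]
    obtain ⟨m, hmM, hm⟩ : ∃ m ≤ M, (∀ x ∈ Icc (u k) (u (k + 1)), 0 ≤ combDeriv d (m + 1) (y + z) x)
        ∨ ∀ x ∈ Icc (u k) (u (k + 1)), combDeriv d (m + 1) (y + z) x ≤ 0 := by
      by_cases hz0 : z = 0
      · refine ⟨0, M.zero_le, Or.inl fun x hx => ?_⟩
        rw [hyz 0 x (hsub k hk hx), hz0]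
        simp [combDeriv]
      · have hnz : ‖z‖ ≠ 0 := norm_ne_zero_iff.2 hz0
        have huk : u k ∈ Icc 0 T := hsub k hk (left_mem_Icc.2 (hle k))
        obtain ⟨m, hmM, hm⟩ := h (‖z‖⁻¹ • z) (Submodule.smul_mem _ _ hz)
          (by rw [norm_smul]; simp [hnz]) (u k) huk
        refine ⟨m, hmM, constant_sign_of_ne_zero (fun x hx =>
          (hder (m + 1) x (hsub k hk hx)).continuousAt.continuousWithinAt) fun x hx h0 => ?_⟩
        rw [hyz m x (hsub k hk hx)] at h0
        refine hm x (hsub k hk hx) ?_ (by rw [combDeriv_smul, h0, mul_zero])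
        have := hx.2
        rw [hstep] at this
        rw [abs_of_nonneg (by linarith [hx.1])]
        linarith
    have := intervalIntegral_abs_deriv_div_le (g := fun k => combDeriv d k (y + z)) m (hle k)
      (fun j x hx => hder j x (hsub k hk hx)) (fun x hx => hB x (hsub k hk hx)) hm
    refine this.trans (mul_le_mul_of_nonneg_right ?_ hlog)
    exact pow_le_pow_right₀ one_le_two (by omega)
  have hint : ∀ k < N, IntervalIntegrable
      (fun t => |combDeriv d 1 c t| / √(1 + combDeriv d 0 c t ^ 2)) volume (u k) (u (k + 1)) :=
    fun k hk => intervalIntegrable_abs_deriv_div (g := fun k => combDeriv d k c) (hle k)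
      fun j x hx => hder j x (hsub k hk hx)
  have hsum := intervalIntegral.sum_integral_adjacent_intervals hint
  rw [hu0, huN] at hsum
  rw [← hsum]
  refine (Finset.sum_le_sum fun k hk => hpiece k (Finset.mem_range.1 hk)).trans ?_
  rw [Finset.sum_const, Finset.card_range, nsmul_eq_mul, mul_assoc]

end Family

section Cubic

/-- The angle in the trigonometric solution of `σ³ - δ σ² - 6 σ + 2 δ = 0`. -/
noncomputable def cubicAngle (δ : ℝ) : ℝ :=
  Real.arccos ((δ / 3) ^ 3 / √(δ ^ 2 / 9 + 2) ^ 3) / 3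

/-- The three real roots of `σ³ - δ σ² - 6 σ + 2 δ`. -/
noncomputable def cubicRoot (δ : ℝ) : Fin 3 → ℝ :=
  ![δ / 3 + √(δ ^ 2 / 9 + 2) * (2 * Real.cos (cubicAngle δ)),
    δ / 3 + √(δ ^ 2 / 9 + 2) * (-Real.cos (cubicAngle δ) + √3 * Real.sin (cubicAngle δ)),
    δ / 3 + √(δ ^ 2 / 9 + 2) * (-Real.cos (cubicAngle δ) - √3 * Real.sin (cubicAngle δ))]

theorem continuous_cubicRoot (j : Fin 3) : Continuous fun δ => cubicRoot δ j := by
  have hr : ∀ δ : ℝ, √(δ ^ 2 / 9 + 2) ^ 3 ≠ 0 := fun δ => by positivity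
  have hθ : Continuous cubicAngle := by
    unfold cubicAngle
    refine (Real.continuous_arccos.comp (Continuous.div (by fun_prop) (by fun_prop) hr)).div_const _
  unfold cubicRoot
  fin_cases j
  · change Continuous fun δ => δ / 3 + √(δ ^ 2 / 9 + 2) * (2 * Real.cos (cubicAngle δ))
    fun_prop
  · change Continuous fun δ => δ / 3 + √(δ ^ 2 / 9 + 2) *
      (-Real.cos (cubicAngle δ) + √3 * Real.sin (cubicAngle δ))
    fun_prop
  · change Continuous fun δ => δ / 3 + √(δ ^ 2 / 9 + 2) *
      (-Real.cos (cubicAngle δ) - √3 * Real.sin (cubicAngle δ))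
    fun_prop

theorem cubicRoot_vieta (δ : ℝ) :
    cubicRoot δ 0 + cubicRoot δ 1 + cubicRoot δ 2 = δ ∧
    cubicRoot δ 0 * cubicRoot δ 1 + cubicRoot δ 1 * cubicRoot δ 2 +
      cubicRoot δ 2 * cubicRoot δ 0 = -6 ∧
    cubicRoot δ 0 * cubicRoot δ 1 * cubicRoot δ 2 = -2 * δ := by
  set θ := cubicAngle δ with hθ
  set r := √(δ ^ 2 / 9 + 2) with hr
  have e0 : cubicRoot δ 0 = δ / 3 + r * (2 * Real.cos θ) := rfl
  have e1 : cubicRoot δ 1 = δ / 3 + r * (-Real.cos θ + √3 * Real.sin θ) := rfl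
  have e2 : cubicRoot δ 2 = δ / 3 + r * (-Real.cos θ - √3 * Real.sin θ) := rfl
  have hr0 : 0 < r := by positivity
  have hr2 : r ^ 2 = δ ^ 2 / 9 + 2 := Real.sq_sqrt (by positivity)
  have h3 : √3 ^ 2 = (3 : ℝ) := Real.sq_sqrt (by norm_num)
  have hcs : Real.sin θ ^ 2 + Real.cos θ ^ 2 = 1 := Real.sin_sq_add_cos_sq θ
  have hle : |(δ / 3) ^ 3 / r ^ 3| ≤ 1 := by
    rw [abs_div, abs_pow, abs_pow, abs_of_pos hr0, div_le_one (by positivity)]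
    exact pow_le_pow_left₀ (abs_nonneg _) (Real.abs_le_sqrt (by nlinarith)) 3
  have hcos : r ^ 3 * (4 * Real.cos θ ^ 3 - 3 * Real.cos θ) = (δ / 3) ^ 3 := by
    rw [← Real.cos_three_mul, hθ, cubicAngle, mul_div_cancel₀ _ (by norm_num : (3 : ℝ) ≠ 0),
      Real.cos_arccos (abs_le.1 hle).1 (abs_le.1 hle).2]
    field_simp
  rw [e0, e1, e2]
  refine ⟨by ring, ?_, ?_⟩
  · linear_combination (-3 * r ^ 2) * hcs - r ^ 2 * Real.sin θ ^ 2 * h3 - 3 * hr2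
  · linear_combination 2 * hcos + (-δ * r ^ 2 - 6 * r ^ 3 * Real.cos θ) * hcs +
      (-r ^ 2 * Real.sin θ ^ 2 * δ / 3 - 2 * r ^ 3 * Real.cos θ * Real.sin θ ^ 2) * h3 - δ * hr2

theorem cubicRoot_eq_zero (δ : ℝ) (j : Fin 3) :
    cubicRoot δ j ^ 3 - δ * cubicRoot δ j ^ 2 - 6 * cubicRoot δ j + 2 * δ = 0 := by
  obtain ⟨h1, h2, h3⟩ := cubicRoot_vieta δ
  fin_cases j
  · change cubicRoot δ 0 ^ 3 - δ * cubicRoot δ 0 ^ 2 - 6 * cubicRoot δ 0 + 2 * δ = 0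
    linear_combination cubicRoot δ 0 ^ 2 * h1 - cubicRoot δ 0 * h2 + h3
  · change cubicRoot δ 1 ^ 3 - δ * cubicRoot δ 1 ^ 2 - 6 * cubicRoot δ 1 + 2 * δ = 0
    linear_combination cubicRoot δ 1 ^ 2 * h1 - cubicRoot δ 1 * h2 + h3
  · change cubicRoot δ 2 ^ 3 - δ * cubicRoot δ 2 ^ 2 - 6 * cubicRoot δ 2 + 2 * δ = 0
    linear_combination cubicRoot δ 2 ^ 2 * h1 - cubicRoot δ 2 * h2 + h3

/-- Triples of complex numbers with the same elementary symmetric functions agree up to order. -/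
theorem sum_eq_of_symmetric_eq {z w : Fin 3 → ℂ} (h1 : z 0 + z 1 + z 2 = w 0 + w 1 + w 2)
    (h2 : z 0 * z 1 + z 1 * z 2 + z 2 * z 0 = w 0 * w 1 + w 1 * w 2 + w 2 * w 0)
    (h3 : z 0 * z 1 * z 2 = w 0 * w 1 * w 2) (g : ℂ → ℝ) : ∑ j, g (z j) = ∑ j, g (w j) := by
  have hp : ∏ j, (X - C (z j)) = ∏ j, (X - C (w j)) := by
    rw [Fin.prod_univ_three, Fin.prod_univ_three]
    have h1' := congrArg (C : ℂ → ℂ[X]) h1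
    have h2' := congrArg (C : ℂ → ℂ[X]) h2
    have h3' := congrArg (C : ℂ → ℂ[X]) h3
    simp only [map_add, map_mul] at h1' h2' h3'
    linear_combination -X ^ 2 * h1' + X * h2' - h3'
  have hr := congrArg roots hp
  have e (u : Fin 3 → ℂ) : (∏ j, (X - C (u j))).roots = Finset.univ.val.map u := by
    rw [← roots_multiset_prod_X_sub_C (Finset.univ.val.map u), Multiset.map_map]
    rfl
  rw [e, e] at hr
  have := congrArg (fun s => (Multiset.map g s).sum) hr
  simpa [Finset.sum] using this

/-- The Levi sum `∑ |M̌(λ_j)| / |𝓛'(λ_j)|` written with the shifted roots: `δ = τ₃ - τ₁`, and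
`m k` are the coefficients of `M̌` at `τ₁`. -/
noncomputable def leviSum (δ : ℝ) (m₀ m₁ m₂ : ℂ) : ℝ :=
  ∑ j, ‖m₀ + m₁ * cubicRoot δ j + m₂ * (cubicRoot δ j : ℂ) ^ 2‖ /
    |3 * cubicRoot δ j ^ 2 - 2 * δ * cubicRoot δ j - 6|

theorem leviSum_eq {δ : ℝ} {m₀ m₁ m₂ : ℂ} {z : Fin 3 → ℂ} (h1 : z 0 + z 1 + z 2 = δ)
    (h2 : z 0 * z 1 + z 1 * z 2 + z 2 * z 0 = -6) (h3 : z 0 * z 1 * z 2 = -2 * δ) :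
    ∑ j : Fin 3, ‖m₀ + m₁ * z j + m₂ * z j ^ 2‖ /
      (‖z j - z (j + 1)‖ * ‖z j - z (j + 2)‖) = leviSum δ m₀ m₁ m₂ := by
  obtain ⟨k1, k2, k3⟩ := cubicRoot_vieta δ
  have hd : ∀ j : Fin 3, ‖z j - z (j + 1)‖ * ‖z j - z (j + 2)‖ =
      ‖3 * z j ^ 2 - 2 * δ * z j - 6‖ := by
    intro j
    rw [← norm_mul]
    congr 1
    fin_cases j
    · change (z 0 - z 1) * (z 0 - z 2) = 3 * z 0 ^ 2 - 2 * δ * z 0 - 6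
      linear_combination -2 * z 0 * h1 + h2
    · change (z 1 - z 2) * (z 1 - z 0) = 3 * z 1 ^ 2 - 2 * δ * z 1 - 6
      linear_combination -2 * z 1 * h1 + h2
    · change (z 2 - z 0) * (z 2 - z 1) = 3 * z 2 ^ 2 - 2 * δ * z 2 - 6
      linear_combination -2 * z 2 * h1 + h2
  simp only [hd]
  rw [sum_eq_of_symmetric_eq (w := fun j => (cubicRoot δ j : ℂ))
    (by rw [h1]; exact_mod_cast k1.symm)
    (by rw [h2]; exact_mod_cast k2.symm) (by rw [h3]; exact_mod_cast k3.symm)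
    (fun x => ‖m₀ + m₁ * x + m₂ * x ^ 2‖ / ‖3 * x ^ 2 - 2 * δ * x - 6‖)]
  unfold leviSum
  refine Finset.sum_congr rfl fun j _ => ?_
  congr 1
  rw [← Real.norm_eq_abs, ← Complex.norm_real]
  push_cast
  rfl

theorem cubicRoot_deriv_mul (δ : ℝ) (j : Fin 3) :
    (3 * cubicRoot δ j ^ 2 - 2 * δ * cubicRoot δ j - 6) * (cubicRoot δ j ^ 2 - 2) =
      cubicRoot δ j ^ 4 + 12 := by
  linear_combination 2 * cubicRoot δ j * cubicRoot_eq_zero δ j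

theorem cubicRoot_deriv_ne_zero (δ : ℝ) (j : Fin 3) :
    3 * cubicRoot δ j ^ 2 - 2 * δ * cubicRoot δ j - 6 ≠ 0 := by
  intro h
  have := cubicRoot_deriv_mul δ j
  rw [h, zero_mul] at this
  have : 0 < cubicRoot δ j ^ 4 + 12 := by positivity
  linarith

theorem continuousOn_leviSum {s : Set ℝ} {δ : ℝ → ℝ} {m₀ m₁ m₂ : ℝ → ℂ} (hδ : ContinuousOn δ s)
    (h0 : ContinuousOn m₀ s) (h1 : ContinuousOn m₁ s) (h2 : ContinuousOn m₂ s) :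
    ContinuousOn (fun t => leviSum (δ t) (m₀ t) (m₁ t) (m₂ t)) s := by
  unfold leviSum
  refine continuousOn_finsetSum _ fun j _ => ?_
  have hr : ContinuousOn (fun t => cubicRoot (δ t) j) s :=
    (continuous_cubicRoot j).comp_continuousOn hδ
  have hr' : ContinuousOn (fun t => (cubicRoot (δ t) j : ℂ)) s :=
    Complex.continuous_ofReal.comp_continuousOn hr
  refine ContinuousOn.div ?_ ?_ fun t _ => abs_ne_zero.2 (cubicRoot_deriv_ne_zero _ _)
  · exact ((h0.add (h1.mul hr')).add (h2.mul (hr'.pow 2))).norm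
  · fun_prop

theorem leviSum_nonneg (δ : ℝ) (m₀ m₁ m₂ : ℂ) : 0 ≤ leviSum δ m₀ m₁ m₂ :=
  Finset.sum_nonneg fun _ _ => by positivity

theorem abs_div_cubicRoot_deriv_le (δ : ℝ) (j : Fin 3) :
    |cubicRoot δ j| / |3 * cubicRoot δ j ^ 2 - 2 * δ * cubicRoot δ j - 6| ≤ 8 / (1 + |δ|) ∧
    cubicRoot δ j ^ 2 / |3 * cubicRoot δ j ^ 2 - 2 * δ * cubicRoot δ j - 6| ≤ 2 := by
  set x := cubicRoot δ j with hx
  have hD := abs_pos.2 (cubicRoot_deriv_ne_zero δ j)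
  have hm := congrArg abs (cubicRoot_deriv_mul δ j)
  have hδ : |δ| * |x ^ 2 - 2| = |x| * |x ^ 2 - 6| := by
    rw [← abs_mul, ← abs_mul]
    congr 1
    linear_combination -cubicRoot_eq_zero δ j
  rw [← hx] at hD hm
  set D := |3 * x ^ 2 - 2 * δ * x - 6|
  rw [abs_mul, abs_of_pos (by positivity : 0 < x ^ 4 + 12)] at hm
  have hx2 : |x| ^ 2 = x ^ 2 := sq_abs x
  have h2 : |x ^ 2 - 2| ≤ x ^ 2 + 2 := abs_le.2 ⟨by nlinarith, by linarith⟩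
  have h6 : |x ^ 2 - 6| ≤ x ^ 2 + 6 := abs_le.2 ⟨by nlinarith, by linarith⟩
  have hx0 := abs_nonneg x
  have hpos : 0 < |x ^ 2 - 2| := by
    rcases (abs_nonneg (x ^ 2 - 2)).eq_or_lt with h | h
    · rw [← h] at hm; nlinarith [sq_nonneg (x ^ 2)]
    · exact h
  constructor
  · rw [div_le_div_iff₀ hD (by positivity)]
    refine le_of_mul_le_mul_right ?_ hpos
    calc |x| * (1 + |δ|) * |x ^ 2 - 2| = |x| * |x ^ 2 - 2| + |x| * (|δ| * |x ^ 2 - 2|) := by ring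
      _ = |x| * |x ^ 2 - 2| + |x| ^ 2 * |x ^ 2 - 6| := by rw [hδ]; ring
      _ ≤ |x| * (x ^ 2 + 2) + |x| ^ 2 * (x ^ 2 + 6) := by gcongr
      _ ≤ 8 * (x ^ 4 + 12) := by
        rw [hx2]
        nlinarith [sq_nonneg (x ^ 2 - 2), sq_nonneg (|x| - 1), sq_nonneg (x ^ 2),
          mul_nonneg (sq_nonneg (|x| - 1)) (sq_nonneg x)]
      _ = 8 * D * |x ^ 2 - 2| := by rw [← hm]; ring
  · rw [div_le_iff₀ hD]
    refine le_of_mul_le_mul_right ?_ hpos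
    calc x ^ 2 * |x ^ 2 - 2| ≤ x ^ 2 * (x ^ 2 + 2) := by gcongr
      _ ≤ 2 * (x ^ 4 + 12) := by nlinarith [sq_nonneg (x ^ 2 - 1)]
      _ = 2 * D * |x ^ 2 - 2| := by rw [← hm]; ring

theorem leviSum_le (δ : ℝ) (m₁ m₂ : ℂ) :
    leviSum δ 0 m₁ m₂ ≤ 24 * (‖m₂‖ + ‖m₁‖ / (1 + |δ|)) := by
  have : ∀ j ∈ Finset.univ, ‖0 + m₁ * cubicRoot δ j + m₂ * (cubicRoot δ j : ℂ) ^ 2‖ /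
      |3 * cubicRoot δ j ^ 2 - 2 * δ * cubicRoot δ j - 6| ≤
        8 * (‖m₂‖ + ‖m₁‖ / (1 + |δ|)) := by
    intro j _
    obtain ⟨h1, h2⟩ := abs_div_cubicRoot_deriv_le δ j
    have hn : ‖0 + m₁ * cubicRoot δ j + m₂ * (cubicRoot δ j : ℂ) ^ 2‖ ≤
        ‖m₁‖ * |cubicRoot δ j| + ‖m₂‖ * cubicRoot δ j ^ 2 := by
      rw [zero_add]
      refine (norm_add_le _ _).trans_eq ?_
      simp
    calc _ ≤ (‖m₁‖ * |cubicRoot δ j| + ‖m₂‖ * cubicRoot δ j ^ 2) /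
        |3 * cubicRoot δ j ^ 2 - 2 * δ * cubicRoot δ j - 6| := by gcongr
      _ = ‖m₁‖ * (|cubicRoot δ j| / |3 * cubicRoot δ j ^ 2 - 2 * δ * cubicRoot δ j - 6|) +
        ‖m₂‖ * (cubicRoot δ j ^ 2 / |3 * cubicRoot δ j ^ 2 - 2 * δ * cubicRoot δ j - 6|) := by
          ring
      _ ≤ ‖m₁‖ * (8 / (1 + |δ|)) + ‖m₂‖ * 2 := by gcongr
      _ ≤ 8 * (‖m₂‖ + ‖m₁‖ / (1 + |δ|)) := by
        have := norm_nonneg m₂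
        have e : ‖m₁‖ * (8 / (1 + |δ|)) = 8 * (‖m₁‖ / (1 + |δ|)) := by ring
        rw [e]; linarith
  refine (Finset.sum_le_card_nsmul _ _ _ this).trans_eq ?_
  simp only [Finset.card_univ, Fintype.card_fin, nsmul_eq_mul]
  push_cast
  ring

theorem abs_cubicRoot_le (δ : ℝ) (j : Fin 3) : |cubicRoot δ j| ≤ 3 + |δ| := by
  set x := cubicRoot δ j with hx
  by_contra! hcon
  have hδ : |δ| * |x ^ 2 - 2| = |x| * |x ^ 2 - 6| := by
    rw [← abs_mul, ← abs_mul]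
    congr 1
    linear_combination -cubicRoot_eq_zero δ j
  have h0 := abs_nonneg δ
  have hx2 : |x| ^ 2 = x ^ 2 := sq_abs x
  have h3 : 3 < |x| := by linarith
  rw [abs_of_pos (by nlinarith : 0 < x ^ 2 - 2), abs_of_pos (by nlinarith : 0 < x ^ 2 - 6),
    ← hx2] at hδ
  nlinarith

theorem abs_cubicRoot_cofactor_le (δ : ℝ) (j : Fin 3) :
    |cubicRoot δ j ^ 2 - δ * cubicRoot δ j - 6| ≤ 7 * (1 + |δ|) := by
  set x := cubicRoot δ j with hx
  have hδ0 := abs_nonneg δ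
  have hp : |x| * |x ^ 2 - δ * x - 6| = 2 * |δ| := by
    rw [← abs_mul, show 2 * |δ| = |-(2 * δ)| by rw [abs_neg, abs_mul, abs_two]]
    congr 1
    linear_combination cubicRoot_eq_zero δ j
  rcases le_total 1 |x| with h | h
  · nlinarith [abs_nonneg (x ^ 2 - δ * x - 6)]
  · have h1 : |x ^ 2 - δ * x - 6| ≤ |x| ^ 2 + |δ| * |x| + 6 := by
      refine (abs_sub _ _).trans ?_
      rw [← abs_pow, ← abs_mul, abs_of_pos (by norm_num : (0 : ℝ) < 6)]
      gcongr
      exact abs_sub _ _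
    nlinarith [abs_nonneg x]

/-- A linear functional of a quadratic polynomial, written by Lagrange interpolation at the roots,
is bounded by the Levi sum. -/
theorem norm_sum_le_leviSum {δ K : ℝ} {m₀ m₁ m₂ : ℂ} {φ : Fin 3 → ℝ} (hφ : ∀ j, |φ j| ≤ K) :
    ‖∑ j, (m₀ + m₁ * cubicRoot δ j + m₂ * (cubicRoot δ j : ℂ) ^ 2) * φ j /
      ((3 * cubicRoot δ j ^ 2 - 2 * δ * cubicRoot δ j - 6 : ℝ) : ℂ)‖ ≤
      K * leviSum δ m₀ m₁ m₂ := by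
  refine (norm_sum_le _ _).trans ?_
  unfold leviSum
  rw [Finset.mul_sum]
  refine Finset.sum_le_sum fun j _ => ?_
  rw [norm_div, norm_mul, Complex.norm_real, Complex.norm_real, Real.norm_eq_abs,
    Real.norm_eq_abs, mul_comm _ |φ j|, mul_div_assoc]
  exact mul_le_mul_of_nonneg_right (hφ j) (by positivity)

theorem cubicRoot_lagrange (δ : ℝ) (m₀ m₁ m₂ : ℂ) :
    m₁ = ∑ j, (m₀ + m₁ * cubicRoot δ j + m₂ * (cubicRoot δ j : ℂ) ^ 2) *
        ((cubicRoot δ j - δ : ℝ) : ℂ) /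
        ((3 * cubicRoot δ j ^ 2 - 2 * δ * cubicRoot δ j - 6 : ℝ) : ℂ) ∧
    m₀ = ∑ j, (m₀ + m₁ * cubicRoot δ j + m₂ * (cubicRoot δ j : ℂ) ^ 2) *
        ((cubicRoot δ j ^ 2 - δ * cubicRoot δ j - 6 : ℝ) : ℂ) /
        ((3 * cubicRoot δ j ^ 2 - 2 * δ * cubicRoot δ j - 6 : ℝ) : ℂ) := by
  obtain ⟨h1, h2, -⟩ := cubicRoot_vieta δ
  have n0 := cubicRoot_deriv_ne_zero δ 0
  have n1 := cubicRoot_deriv_ne_zero δ 1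
  rw [Fin.sum_univ_three, Fin.sum_univ_three]
  set x := cubicRoot δ 0
  set y := cubicRoot δ 1
  set z := cubicRoot δ 2
  have d0 : 3 * x ^ 2 - 2 * δ * x - 6 = (x - y) * (x - z) := by
    linear_combination 2 * x * h1 - h2
  have d1 : 3 * y ^ 2 - 2 * δ * y - 6 = -((x - y) * (y - z)) := by
    linear_combination 2 * y * h1 - h2
  have d2 : 3 * z ^ 2 - 2 * δ * z - 6 = (x - z) * (y - z) := by
    linear_combination 2 * z * h1 - h2
  have c0 : x ^ 2 - δ * x - 6 = y * z := by linear_combination x * h1 - h2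
  have c1 : y ^ 2 - δ * y - 6 = z * x := by linear_combination y * h1 - h2
  have c2 : z ^ 2 - δ * z - 6 = x * y := by linear_combination z * h1 - h2
  have b0 : x - δ = -(y + z) := by linear_combination h1
  have b1 : y - δ = -(z + x) := by linear_combination h1
  have b2 : z - δ = -(x + y) := by linear_combination h1
  rw [d0] at n0
  rw [d1] at n1
  have hxy : ((x : ℂ) - y) ≠ 0 := by exact_mod_cast left_ne_zero_of_mul n0
  have hxz : ((x : ℂ) - z) ≠ 0 := by exact_mod_cast right_ne_zero_of_mul n0
  have hyz : ((y : ℂ) - z) ≠ 0 := by exact_mod_cast right_ne_zero_of_mul (neg_ne_zero.1 n1)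
  rw [d0, d1, d2, b0, b1, b2, c0, c1, c2]
  push_cast
  constructor
  · field_simp
    ring
  · field_simp
    ring

theorem norm_le_leviSum (δ : ℝ) (m₀ m₁ m₂ : ℂ) :
    ‖m₀‖ ≤ 7 * (1 + |δ|) * leviSum δ m₀ m₁ m₂ ∧ ‖m₁‖ ≤ 7 * (1 + |δ|) * leviSum δ m₀ m₁ m₂ := by
  obtain ⟨h1, h0⟩ := cubicRoot_lagrange δ m₀ m₁ m₂
  constructor
  · conv_lhs => rw [h0]
    exact norm_sum_le_leviSum fun j => abs_cubicRoot_cofactor_le δ j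
  · conv_lhs => rw [h1]
    refine norm_sum_le_leviSum fun j => (abs_sub _ _).trans ?_
    have := abs_cubicRoot_le δ j
    have := abs_nonneg δ
    linarith

end Cubic

section Reduction

variable {n : ℕ} {T : ℝ} {a : Coeffs n}

/-- The square `(τ₃ - τ₁)²` in terms of the coefficients of `L`. -/
noncomputable def gapSq (a : Coeffs n) (t : ℝ) (ξ : Freq n) : ℂ :=
  coeffForm a 2 1 t ξ ^ 2 - 3 * coeffForm a 1 2 t ξ

/-- The cube `(τ₃ - τ₁)³` in terms of the coefficients of `L`. -/
noncomputable def gapCube (a : Coeffs n) (t : ℝ) (ξ : Freq n) : ℂ :=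
  -coeffForm a 2 1 t ξ ^ 3 + 9 / 2 * (coeffForm a 2 1 t ξ * coeffForm a 1 2 t ξ) -
    27 / 2 * coeffForm a 0 3 t ξ

/-- The difference `τ₃ - τ₁` in terms of the coefficients of `L`. -/
noncomputable def gap (a : Coeffs n) (t : ℝ) (ξ : Freq n) : ℝ :=
  (gapCube a t ξ).re / (gapSq a t ξ).re

/-- The double root `τ₁` in terms of the coefficients of `L`. -/
noncomputable def doubleRoot (a : Coeffs n) (t : ℝ) (ξ : Freq n) : ℝ :=
  (-(coeffForm a 2 1 t ξ).re - gap a t ξ) / 3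

/-- The coefficients of `M̌` in powers of `τ - τ₁`. -/
noncomputable def shiftCoeff (a : Coeffs n) : ℕ → ℝ → Freq n → ℂ
  | 0, t, ξ => mcheckCoeff a 0 t ξ + mcheckCoeff a 1 t ξ * doubleRoot a t ξ +
      mcheckCoeff a 2 t ξ * (doubleRoot a t ξ : ℂ) ^ 2
  | 1, t, ξ => mcheckCoeff a 1 t ξ + 2 * mcheckCoeff a 2 t ξ * doubleRoot a t ξ
  | _, t, ξ => mcheckCoeff a 2 t ξ

theorem gap_smul (t s : ℝ) (ξ : Freq n) : gap a t (s • ξ) = s * gap a t ξ := by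
  have h2 : gapSq a t (s • ξ) = ((s ^ 2 : ℝ) : ℂ) * gapSq a t ξ := by
    simp only [gapSq, coeffForm_smul]; push_cast; ring
  have h3 : gapCube a t (s • ξ) = ((s ^ 3 : ℝ) : ℂ) * gapCube a t ξ := by
    simp only [gapCube, coeffForm_smul]; push_cast; ring
  rw [gap, gap, h2, h3, Complex.re_ofReal_mul, Complex.re_ofReal_mul]
  by_cases hs : s = 0
  · simp [hs]
  · rw [show s ^ 3 = s ^ 2 * s by ring, mul_assoc, mul_div_mul_left _ _ (pow_ne_zero 2 hs),
      mul_div_assoc]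

theorem doubleRoot_smul (t s : ℝ) (ξ : Freq n) :
    doubleRoot a t (s • ξ) = s * doubleRoot a t ξ := by
  rw [doubleRoot, doubleRoot, gap_smul, coeffForm_smul, pow_one, Complex.re_ofReal_mul]
  ring

theorem shiftCoeff_smul (k : ℕ) (hk : k ≤ 2) (t s : ℝ) (ξ : Freq n) :
    shiftCoeff a k t (s • ξ) = (s : ℂ) ^ (2 - k) * shiftCoeff a k t ξ := by
  interval_cases k <;>
    simp only [shiftCoeff, mcheckCoeff_smul _ _ (by norm_num : 0 ≤ 2),
      mcheckCoeff_smul _ _ (by norm_num : 1 ≤ 2), mcheckCoeff_smul _ _ (by norm_num : 2 ≤ 2),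
      doubleRoot_smul, Complex.ofReal_mul] <;> ring

section Roots

variable {τ : Fin 3 → ℝ → Freq n → ℝ}

theorem coeffForm_eq_of_roots {t : ℝ} {ξ : Freq n}
    (hτ : IsRootList (symL a t ξ) (fun j => (τ j t ξ : ℂ))) (h12 : τ 0 t ξ = τ 1 t ξ) :
    coeffForm a 2 1 t ξ = -(2 * τ 0 t ξ + τ 2 t ξ : ℝ) ∧
    coeffForm a 1 2 t ξ = (τ 0 t ξ ^ 2 + 2 * τ 0 t ξ * τ 2 t ξ : ℝ) ∧
    coeffForm a 0 3 t ξ = -(τ 0 t ξ ^ 2 * τ 2 t ξ : ℝ) := by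
  rw [symL_eq] at hτ
  obtain ⟨h1, h2, h3⟩ := hτ.vieta
  rw [← h12] at h1 h2 h3
  push_cast
  refine ⟨by linear_combination h1, by linear_combination -h2, by linear_combination h3⟩

theorem gapSq_eq {t : ℝ} {ξ : Freq n}
    (hτ : IsRootList (symL a t ξ) (fun j => (τ j t ξ : ℂ))) (h12 : τ 0 t ξ = τ 1 t ξ) :
    gapSq a t ξ = ((τ 2 t ξ - τ 0 t ξ : ℝ) : ℂ) ^ 2 := by
  obtain ⟨h1, h2, h3⟩ := coeffForm_eq_of_roots hτ h12
  rw [gapSq, h1, h2]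
  push_cast
  ring

theorem gapCube_eq {t : ℝ} {ξ : Freq n}
    (hτ : IsRootList (symL a t ξ) (fun j => (τ j t ξ : ℂ))) (h12 : τ 0 t ξ = τ 1 t ξ) :
    gapCube a t ξ = ((τ 2 t ξ - τ 0 t ξ : ℝ) : ℂ) ^ 3 := by
  obtain ⟨h1, h2, h3⟩ := coeffForm_eq_of_roots hτ h12
  rw [gapCube, h1, h2, h3]
  push_cast
  ring

theorem gap_eq {t : ℝ} {ξ : Freq n}
    (hτ : IsRootList (symL a t ξ) (fun j => (τ j t ξ : ℂ))) (h12 : τ 0 t ξ = τ 1 t ξ) :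
    gap a t ξ = τ 2 t ξ - τ 0 t ξ := by
  rw [gap, gapSq_eq hτ h12, gapCube_eq hτ h12, ← Complex.ofReal_pow, ← Complex.ofReal_pow,
    Complex.ofReal_re, Complex.ofReal_re]
  by_cases h : τ 2 t ξ - τ 0 t ξ = 0
  · simp [h]
  · field_simp

theorem doubleRoot_eq {t : ℝ} {ξ : Freq n}
    (hτ : IsRootList (symL a t ξ) (fun j => (τ j t ξ : ℂ))) (h12 : τ 0 t ξ = τ 1 t ξ) :
    doubleRoot a t ξ = τ 0 t ξ := by
  rw [doubleRoot, gap_eq hτ h12, (coeffForm_eq_of_roots hτ h12).1, ← Complex.ofReal_neg,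
    Complex.ofReal_re]
  ring

theorem disc1_eq {t : ℝ} {ξ : Freq n}
    (hτ : IsRootList (symL a t ξ) (fun j => (τ j t ξ : ℂ))) (h12 : τ 0 t ξ = τ 1 t ξ) :
    √(disc1 τ t ξ) = √2 * |gap a t ξ| := by
  rw [gap_eq hτ h12, ← Real.sqrt_sq_eq_abs, ← Real.sqrt_mul (by norm_num), disc1, ← h12]
  congr 1
  ring

theorem symMcheck_eq_shift {t : ℝ} {ξ : Freq n}
    (hτ : IsRootList (symL a t ξ) (fun j => (τ j t ξ : ℂ))) (h12 : τ 0 t ξ = τ 1 t ξ) :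
    symMcheck a t ξ = C (shiftCoeff a 0 t ξ) + (X - C (τ 0 t ξ : ℂ)) *
      (C (shiftCoeff a 1 t ξ) + C (shiftCoeff a 2 t ξ) * (X - C (τ 0 t ξ : ℂ))) := by
  simp only [symMcheck_eq, shiftCoeff, doubleRoot_eq hτ h12, map_add, map_mul, map_pow]
  have h2 : (C (2 : ℂ)) = 2 := rfl
  rw [h2]
  ring

theorem eval_symMcheck {t : ℝ} {ξ : Freq n}
    (hτ : IsRootList (symL a t ξ) (fun j => (τ j t ξ : ℂ))) (h12 : τ 0 t ξ = τ 1 t ξ) :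
    (symMcheck a t ξ).eval (τ 0 t ξ : ℂ) = shiftCoeff a 0 t ξ := by
  rw [symMcheck_eq_shift hτ h12]
  simp

theorem quotQ_eq {t : ℝ} {ξ : Freq n}
    (hτ : IsRootList (symL a t ξ) (fun j => (τ j t ξ : ℂ))) (h12 : τ 0 t ξ = τ 1 t ξ) :
    quotQ a τ t ξ = C (shiftCoeff a 1 t ξ) + C (shiftCoeff a 2 t ξ) * (X - C (τ 0 t ξ : ℂ)) := by
  refine (div_modByMonic_unique _ (C (shiftCoeff a 0 t ξ)) (monic_X_sub_C _)
    ⟨(symMcheck_eq_shift hτ h12).symm, ?_⟩).1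
  rw [degree_X_sub_C]
  exact lt_of_le_of_lt degree_C_le (by norm_num)

theorem eval_quotQ {t : ℝ} {ξ : Freq n}
    (hτ : IsRootList (symL a t ξ) (fun j => (τ j t ξ : ℂ))) (h12 : τ 0 t ξ = τ 1 t ξ) :
    (quotQ a τ t ξ).eval (τ 0 t ξ : ℂ) = shiftCoeff a 1 t ξ ∧
    (quotQ a τ t ξ).eval (τ 2 t ξ : ℂ) = shiftCoeff a 1 t ξ + shiftCoeff a 2 t ξ * gap a t ξ := by
  rw [quotQ_eq hτ h12, gap_eq hτ h12]
  constructor <;> simp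

theorem leviIntegrand_eq {t : ℝ} {ξ : Freq n} {lam : Fin 3 → ℝ → Freq n → ℂ}
    (hτ : IsRootList (symL a t ξ) (fun j => (τ j t ξ : ℂ))) (h12 : τ 0 t ξ = τ 1 t ξ)
    (hlam : IsRootList (auxL a t ξ) (fun j => lam j t ξ)) :
    ∑ j : Fin 3, ‖(symMcheck a t ξ).eval (lam j t ξ)‖ /
      (‖lam j t ξ - lam (j + 1) t ξ‖ * ‖lam j t ξ - lam (j + 2) t ξ‖) =
    leviSum (gap a t ξ) (shiftCoeff a 0 t ξ) (shiftCoeff a 1 t ξ) (shiftCoeff a 2 t ξ) := by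
  rw [auxL_eq] at hlam
  obtain ⟨h1, h2, h3⟩ := hlam.vieta
  obtain ⟨k1, k2, k3⟩ := coeffForm_eq_of_roots hτ h12
  rw [k1] at h1 h3
  rw [k2] at h2
  rw [k3] at h3
  push_cast at h1 h2 h3
  rw [gap_eq hτ h12, ← leviSum_eq (z := fun j => lam j t ξ - τ 0 t ξ)]
  · refine Finset.sum_congr rfl fun j _ => ?_
    rw [symMcheck_eq_shift hτ h12]
    simp only [eval_add, eval_mul, eval_C, eval_sub, eval_X, sub_sub_sub_cancel_right]
    congr 2
    ring
  · push_cast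
    linear_combination h1
  · linear_combination h2 - 2 * (τ 0 t ξ : ℂ) * h1
  · push_cast
    linear_combination h3 - (τ 0 t ξ : ℂ) * h2 + (τ 0 t ξ : ℂ) ^ 2 * h1

theorem gap_add {t : ℝ} (hτ : ∀ ξ : Freq n, IsRootList (symL a t ξ) (fun j => (τ j t ξ : ℂ)))
    (h12 : ∀ ξ : Freq n, τ 0 t ξ = τ 1 t ξ) (ξ η : Freq n) :
    gap a t (ξ + η) = gap a t ξ + gap a t η := by
  obtain ⟨p1, hp1, e1⟩ := exists_polynomial_coeffForm_line a 2 1 t ξ (η - ξ)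
  obtain ⟨p2, hp2, e2⟩ := exists_polynomial_coeffForm_line a 1 2 t ξ (η - ξ)
  obtain ⟨p3, hp3, e3⟩ := exists_polynomial_coeffForm_line a 0 3 t ξ (η - ξ)
  have hq : (p1 ^ 2 - C 3 * p2).natDegree ≤ 2 := by
    refine (natDegree_sub_le_of_le (m := 2) (natDegree_pow_le.trans ?_)
      ((natDegree_C_mul_le _ _).trans hp2)).trans (max_self 2).le
    omega
  have key := midpoint_of_sq_cube_polynomial (g := fun s => gap a t (ξ + s • (η - ξ))) hq
    (c := -p1 ^ 3 + C (9 / 2) * (p1 * p2) - C (27 / 2) * p3)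
    (fun s => by
      rw [gap_eq (hτ _) (h12 _), ← gapSq_eq (hτ _) (h12 _), gapSq, e1, e2]
      simp)
    (fun s => by
      rw [gap_eq (hτ _) (h12 _), ← gapCube_eq (hτ _) (h12 _), gapCube, e1, e2, e3]
      simp)
  have hmid : ξ + (1 / 2 : ℝ) • (η - ξ) = (1 / 2 : ℝ) • (ξ + η) := by module
  simp only [hmid, gap_smul, zero_smul, add_zero, one_smul, add_sub_cancel] at key
  linarith

theorem gap_eq_combDeriv {t : ℝ}
    (hτ : ∀ ξ : Freq n, IsRootList (symL a t ξ) (fun j => (τ j t ξ : ℂ)))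
    (h12 : ∀ ξ : Freq n, τ 0 t ξ = τ 1 t ξ) (ξ : Freq n) :
    gap a t ξ = combDeriv (fun i s => gap a s (EuclideanSpace.single i 1)) 0 ξ t := by
  let ℓ : Freq n →ₗ[ℝ] ℝ :=
    { toFun := gap a t
      map_add' := gap_add hτ h12
      map_smul' := fun s ξ => gap_smul t s ξ }
  have h := congrArg ℓ ((EuclideanSpace.basisFun (Fin n) ℝ).sum_repr ξ)
  rw [map_sum] at h
  simp only [map_smul, EuclideanSpace.basisFun_apply, EuclideanSpace.basisFun_repr,
    smul_eq_mul] at h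
  simp only [combDeriv, iteratedDeriv_zero]
  exact h.symm

end Roots

section Analytic

variable {τ : Fin 3 → ℝ → Freq n → ℝ}

theorem eventually_eq_of_eqOn_Icc (hT : 0 < T) {f g : ℝ → ℝ} {t : ℝ} (ht : t ∈ Icc 0 T)
    (hf : AnalyticAt ℝ f t) (hg : AnalyticAt ℝ g t) (h : EqOn f g (Icc 0 T)) :
    ∀ᶠ s in 𝓝 t, f s = g s := by
  rw [← hf.frequently_eq_iff_eventually_eq hg]
  have hacc : AccPt t (𝓟 (Icc 0 T)) := isPreconnected_Icc.preperfect_of_nontrivial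
    ⟨0, left_mem_Icc.2 hT.le, T, right_mem_Icc.2 hT.le, hT.ne⟩ t ht
  exact (accPt_iff_frequently_nhdsNE.1 hacc).mono fun s hs => h hs

theorem analyticAt_re {f : ℝ → ℂ} {t : ℝ} (hf : AnalyticAt ℝ f t) :
    AnalyticAt ℝ (fun s => (f s).re) t :=
  (Complex.reCLM.analyticAt _).comp hf

theorem analyticAt_ofReal {f : ℝ → ℝ} {t : ℝ} (hf : AnalyticAt ℝ f t) :
    AnalyticAt ℝ (fun s => (f s : ℂ)) t :=
  (Complex.ofRealCLM.analyticAt _).comp hf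

/-- The standing assumptions: analytic coefficients and real roots, two of which coincide. -/
structure IsDoubleRootSymbol (T : ℝ) (a : Coeffs n) (τ : Fin 3 → ℝ → Freq n → ℝ) : Prop where
  pos : 0 < T
  analytic : ∀ (j : ℕ) (α : Fin n → ℕ), j < 3 → (j + ∑ i, α i = 2 ∨ j + ∑ i, α i = 3) →
    AnalyticOnNhd ℝ (a j α) (Icc 0 T)
  roots : ∀ t ∈ Icc 0 T, ∀ ξ : Freq n, IsRootList (symL a t ξ) (fun j => (τ j t ξ : ℂ))
  double : ∀ t ∈ Icc 0 T, ∀ ξ : Freq n, τ 0 t ξ = τ 1 t ξ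

namespace IsDoubleRootSymbol

theorem analyticOnNhd_coeffForm_three (h : IsDoubleRootSymbol T a τ) (ξ : Freq n) (j k : ℕ)
    (hj : j < 3) (hk : j + k = 3) : AnalyticOnNhd ℝ (fun t => coeffForm a j k t ξ) (Icc 0 T) :=
  analyticOnNhd_coeffForm a j k ξ fun α hα => h.analytic j α hj (by omega)

theorem analyticOnNhd_gap (h : IsDoubleRootSymbol T a τ) (ξ : Freq n) :
    AnalyticOnNhd ℝ (fun t => gap a t ξ) (Icc 0 T) := by
  intro t ht
  have h1 := h.analyticOnNhd_coeffForm_three ξ 2 1 (by norm_num) rfl t ht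
  have h2 := h.analyticOnNhd_coeffForm_three ξ 1 2 (by norm_num) rfl t ht
  have h3 := h.analyticOnNhd_coeffForm_three ξ 0 3 (by norm_num) rfl t ht
  have hq : AnalyticAt ℝ (fun t => (gapSq a t ξ).re) t :=
    analyticAt_re ((h1.pow 2).sub (analyticAt_const.mul h2))
  have hc : AnalyticAt ℝ (fun t => (gapCube a t ξ).re) t :=
    analyticAt_re (((h1.pow 3).neg.add (analyticAt_const.mul (h1.mul h2))).sub
      (analyticAt_const.mul h3))
  refine analyticAt_div_of_sq_eq_cube hc hq (eventually_eq_of_eqOn_Icc h.pos ht (hc.pow 2) (hq.pow 3) ?_)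
  intro s hs
  change (gapCube a s ξ).re ^ 2 = (gapSq a s ξ).re ^ 3
  rw [gapSq_eq (h.roots s hs ξ) (h.double s hs ξ), gapCube_eq (h.roots s hs ξ) (h.double s hs ξ),
    ← Complex.ofReal_pow, ← Complex.ofReal_pow, Complex.ofReal_re, Complex.ofReal_re]
  ring

theorem analyticOnNhd_doubleRoot (h : IsDoubleRootSymbol T a τ) (ξ : Freq n) :
    AnalyticOnNhd ℝ (fun t => doubleRoot a t ξ) (Icc 0 T) := fun t ht =>
  ((analyticAt_re (h.analyticOnNhd_coeffForm_three ξ 2 1 (by norm_num) rfl t ht)).neg.sub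
    (h.analyticOnNhd_gap ξ t ht)).div_const

theorem analyticOnNhd_shiftCoeff (h : IsDoubleRootSymbol T a τ) (k : ℕ) (hk : k ≤ 2)
    (ξ : Freq n) : AnalyticOnNhd ℝ (fun t => shiftCoeff a k t ξ) (Icc 0 T) := by
  intro t ht
  have h0 := analyticOnNhd_mcheckCoeff a h.analytic 0 (by norm_num) ξ t ht
  have h1 := analyticOnNhd_mcheckCoeff a h.analytic 1 (by norm_num) ξ t ht
  have h2 := analyticOnNhd_mcheckCoeff a h.analytic 2 (by norm_num) ξ t ht
  have hr := analyticAt_ofReal (h.analyticOnNhd_doubleRoot ξ t ht)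
  interval_cases k <;> simp only [shiftCoeff]
  · exact (h0.add (h1.mul hr)).add (h2.mul (hr.pow 2))
  · exact h1.add ((analyticAt_const.mul h2).mul hr)
  · exact h2

theorem gap_eq_combDeriv (h : IsDoubleRootSymbol T a τ) (ξ : Freq n) {t : ℝ}
    (ht : t ∈ Icc 0 T) :
    gap a t ξ = combDeriv (fun i s => gap a s (EuclideanSpace.single i 1)) 0 ξ t :=
  ThirdOrder.gap_eq_combDeriv (h.roots t ht) (h.double t ht) ξ

theorem intervalIntegrable_leviSum (h : IsDoubleRootSymbol T a τ) (ξ : Freq n) :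
    IntervalIntegrable (fun t => leviSum (gap a t ξ) (shiftCoeff a 0 t ξ) (shiftCoeff a 1 t ξ)
      (shiftCoeff a 2 t ξ)) volume 0 T := by
  apply ContinuousOn.intervalIntegrable
  rw [uIcc_of_le h.pos.le]
  exact continuousOn_leviSum (h.analyticOnNhd_gap ξ).continuousOn
    (h.analyticOnNhd_shiftCoeff 0 (by norm_num) ξ).continuousOn
    (h.analyticOnNhd_shiftCoeff 1 (by norm_num) ξ).continuousOn
    (h.analyticOnNhd_shiftCoeff 2 (by norm_num) ξ).continuousOn

theorem leviM_iff (h : IsDoubleRootSymbol T a τ) {lam : Fin 3 → ℝ → Freq n → ℂ}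
    (hlam : ∀ t ∈ Icc 0 T, ∀ ξ : Freq n, IsRootList (auxL a t ξ) (fun j => lam j t ξ)) :
    LeviM T a lam ↔ ∀ R : ℝ, 0 < R → ∃ K : ℝ, 0 < K ∧ ∀ ξ : Freq n, R ≤ ‖ξ‖ →
      ∫ t in (0 : ℝ)..T, leviSum (gap a t ξ) (shiftCoeff a 0 t ξ) (shiftCoeff a 1 t ξ)
        (shiftCoeff a 2 t ξ) ≤ K * Real.log (1 + ‖ξ‖) := by
  unfold LeviM LogCondition
  have e : ∀ ξ : Freq n, ∀ t ∈ uIcc 0 T, ∑ j : Fin 3, ‖(symMcheck a t ξ).eval (lam j t ξ)‖ /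
      (‖lam j t ξ - lam (j + 1) t ξ‖ * ‖lam j t ξ - lam (j + 2) t ξ‖) =
      leviSum (gap a t ξ) (shiftCoeff a 0 t ξ) (shiftCoeff a 1 t ξ) (shiftCoeff a 2 t ξ) := by
    intro ξ t ht
    rw [uIcc_of_le h.pos.le] at ht
    exact leviIntegrand_eq (h.roots t ht ξ) (h.double t ht ξ) (hlam t ht ξ)
  have hint : ∀ ξ : Freq n, ∫ t in (0 : ℝ)..T, |∑ j : Fin 3,
      ‖(symMcheck a t ξ).eval (lam j t ξ)‖ /
        (‖lam j t ξ - lam (j + 1) t ξ‖ * ‖lam j t ξ - lam (j + 2) t ξ‖)| =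
      ∫ t in (0 : ℝ)..T, leviSum (gap a t ξ) (shiftCoeff a 0 t ξ) (shiftCoeff a 1 t ξ)
        (shiftCoeff a 2 t ξ) := fun ξ => intervalIntegral.integral_congr fun t ht => by
    simp only [e ξ t ht, abs_of_nonneg (leviSum_nonneg _ _ _ _)]
  refine forall₂_congr fun R _ => exists_congr fun K => and_congr_right fun _ =>
    forall₂_congr fun ξ _ => ?_
  rw [hint ξ]
  refine and_iff_right ((h.intervalIntegrable_leviSum ξ).congr fun t ht => ?_)
  exact (e ξ t (uIoc_subset_uIcc ht)).symm

theorem mcheckVanishes_iff (h : IsDoubleRootSymbol T a τ) :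
    McheckVanishes T a τ ↔ ∀ t ∈ Icc 0 T, ∀ ξ : Freq n, shiftCoeff a 0 t ξ = 0 :=
  forall₂_congr fun t ht => forall_congr' fun ξ => by
    rw [eval_symMcheck (h.roots t ht ξ) (h.double t ht ξ)]

theorem exists_norm_shiftCoeff_two_le (h : IsDoubleRootSymbol T a τ) :
    ∃ K : ℝ, 0 < K ∧ ∀ t ∈ Icc 0 T, ∀ ξ : Freq n, ‖shiftCoeff a 2 t ξ‖ ≤ K := by
  obtain ⟨K, hK⟩ := isCompact_Icc.exists_bound_of_continuousOn
    (h.analyticOnNhd_shiftCoeff 2 le_rfl 0).continuousOn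
  refine ⟨max K 1, by positivity, fun t ht ξ => ?_⟩
  have : shiftCoeff a 2 t ξ = shiftCoeff a 2 t 0 := by
    have := shiftCoeff_smul (a := a) 2 le_rfl t 0 ξ
    simpa using this.symm
  rw [this]
  exact (hK t ht).trans (le_max_left _ _)

end IsDoubleRootSymbol

end Analytic

end Reduction

section Sufficiency

variable {n : ℕ} {T : ℝ} {a : Coeffs n} {τ : Fin 3 → ℝ → Freq n → ℝ}

/-- The coefficients of the linear form `ξ ↦ τ₃ - τ₁`. -/
noncomputable def gapCoeff (a : Coeffs n) (i : Fin n) (t : ℝ) : ℝ :=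
  gap a t (EuclideanSpace.single i 1)

theorem abs_combDeriv_zero_le {d : Fin n → ℝ → ℝ} {D : ℝ} {t : ℝ} (hD : ∀ i, |d i t| ≤ D)
    (c : Freq n) : |combDeriv d 0 c t| ≤ n * D * ‖c‖ := by
  simp only [combDeriv, iteratedDeriv_zero]
  refine (Finset.abs_sum_le_sum_abs _ _).trans ?_
  have : ∀ i ∈ Finset.univ, |c i * d i t| ≤ D * ‖c‖ := by
    intro i _
    rw [abs_mul, mul_comm]
    exact mul_le_mul (hD i) (PiLp.norm_apply_le c i) (abs_nonneg _)
      ((abs_nonneg _).trans (hD i))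
  refine (Finset.sum_le_card_nsmul _ _ _ this).trans_eq ?_
  simp [mul_assoc]

/-- A bound by a constant plus a logarithm is a logarithmic bound away from zero. -/
theorem add_log_le_log {A N D R x : ℝ} (hA : 0 ≤ A) (hN : 0 ≤ N) (hD : 0 ≤ D) (hR : 0 < R)
    (hx : R ≤ x) :
    A + N * Real.log (1 + D * x) ≤
      (((A + N * Real.log (1 + D)) / Real.log (1 + R)) + N) * Real.log (1 + x) := by
  have hx0 : 0 < x := hR.trans_le hx
  have hlR : 0 < Real.log (1 + R) := Real.log_pos (by linarith)
  have hlx : Real.log (1 + R) ≤ Real.log (1 + x) := Real.log_le_log (by linarith) (by linarith)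
  have hlD : 0 ≤ Real.log (1 + D) := Real.log_nonneg (by linarith)
  have h1 : Real.log (1 + D * x) ≤ Real.log (1 + D) + Real.log (1 + x) := by
    rw [← Real.log_mul (by positivity) (by positivity)]
    exact Real.log_le_log (by positivity) (by nlinarith)
  have h2 : A + N * Real.log (1 + D) ≤
      (A + N * Real.log (1 + D)) / Real.log (1 + R) * Real.log (1 + x) := by
    rw [div_mul_eq_mul_div, le_div_iff₀ hlR]
    exact mul_le_mul_of_nonneg_left hlx (by positivity)
  nlinarith [mul_le_mul_of_nonneg_left h1 hN]

namespace IsDoubleRootSymbol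

theorem hasDerivAt_gapComb (h : IsDoubleRootSymbol T a τ) (ξ : Freq n) {t : ℝ}
    (ht : t ∈ Icc 0 T) (k : ℕ) :
    HasDerivAt (combDeriv (gapCoeff a) k ξ) (combDeriv (gapCoeff a) (k + 1) ξ t) t :=
  hasDerivAt_combDeriv (fun i => h.analyticOnNhd_gap (EuclideanSpace.single i 1) t ht) k ξ

theorem sqrt_disc1_eq (h : IsDoubleRootSymbol T a τ) (ξ : Freq n) {t : ℝ}
    (ht : t ∈ Icc 0 T) : √(disc1 τ t ξ) = √2 * |combDeriv (gapCoeff a) 0 ξ t| := by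
  rw [disc1_eq (h.roots t ht ξ) (h.double t ht ξ), h.gap_eq_combDeriv ξ ht]
  rfl

theorem norm_shiftCoeff_one_le_of_ne_zero (h : IsDoubleRootSymbol T a τ) {K : ℝ}
    (hK : ∀ t ∈ Icc 0 T, ∀ ξ : Freq n, ∀ d : ℝ,
      HasDerivWithinAt (fun s => √(disc1 τ s ξ)) d (Icc 0 T) t →
        ‖shiftCoeff a 1 t ξ‖ ≤ K * (√(disc1 τ t ξ) + |d|)) {t : ℝ} (ht : t ∈ Icc 0 T) (ξ : Freq n)
    (h0 : combDeriv (gapCoeff a) 0 ξ t ≠ 0) :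
    ‖shiftCoeff a 1 t ξ‖ ≤
      K * √2 * (|combDeriv (gapCoeff a) 0 ξ t| + |combDeriv (gapCoeff a) 1 ξ t|) := by
  have hd := ((hasDerivAt_abs h0).comp t (h.hasDerivAt_gapComb ξ ht 0)).const_mul √2
  have hw := hd.hasDerivWithinAt (s := Icc 0 T)
  have := hK t ht ξ _ (hw.congr (fun s hs => h.sqrt_disc1_eq ξ hs) (h.sqrt_disc1_eq ξ ht))
  refine this.trans_eq ?_
  rw [h.sqrt_disc1_eq ξ ht, abs_mul, abs_mul, abs_of_nonneg (Real.sqrt_nonneg 2)]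
  have hs : |((SignType.sign (combDeriv (gapCoeff a) 0 ξ t) : SignType) : ℝ)| = 1 := by
    rcases lt_or_gt_of_ne h0 with h' | h'
    · simp [sign_neg h']
    · simp [sign_pos h']
  rw [hs]
  ring

theorem norm_shiftCoeff_one_le (h : IsDoubleRootSymbol T a τ) {K : ℝ} (hK0 : 0 < K)
    (hK : ∀ t ∈ Icc 0 T, ∀ ξ : Freq n, ∀ d : ℝ,
      HasDerivWithinAt (fun s => √(disc1 τ s ξ)) d (Icc 0 T) t →
        ‖shiftCoeff a 1 t ξ‖ ≤ K * (√(disc1 τ t ξ) + |d|)) {t : ℝ} (ht : t ∈ Icc 0 T)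
    (ξ : Freq n) :
    ‖shiftCoeff a 1 t ξ‖ ≤
      K * √2 * (|combDeriv (gapCoeff a) 0 ξ t| + |combDeriv (gapCoeff a) 1 ξ t|) := by
  have han : AnalyticAt ℝ (fun s => gap a s ξ) t := h.analyticOnNhd_gap ξ t ht
  rcases han.eventually_eq_zero_or_eventually_ne_zero with hz | hz
  · have hd : HasDerivWithinAt (fun s => √(disc1 τ s ξ)) 0 (Icc 0 T) t := by
      have hz' : ∀ᶠ s in 𝓝[Icc 0 T] t, √(disc1 τ s ξ) = 0 := by
        filter_upwards [hz.filter_mono nhdsWithin_le_nhds, self_mem_nhdsWithin] with s hs hsm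
        rw [disc1_eq (h.roots s hsm ξ) (h.double s hsm ξ), hs]
        simp
      exact (hasDerivWithinAt_const t (Icc 0 T) (0 : ℝ)).congr_of_eventuallyEq hz'
        (hz'.self_of_nhdsWithin ht)
    have := hK t ht ξ 0 hd
    rw [disc1_eq (h.roots t ht ξ) (h.double t ht ξ), hz.self_of_nhds] at this
    have h0 : ‖shiftCoeff a 1 t ξ‖ ≤ 0 := by simpa using this
    exact h0.trans (by positivity)
  · have hacc : AccPt t (𝓟 (Icc 0 T)) := isPreconnected_Icc.preperfect_of_nontrivial
      ⟨0, left_mem_Icc.2 h.pos.le, T, right_mem_Icc.2 h.pos.le, h.pos.ne⟩ t ht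
    have hc1 : ContinuousAt (fun s => ‖shiftCoeff a 1 s ξ‖) t :=
      (h.analyticOnNhd_shiftCoeff 1 (by norm_num) ξ t ht).continuousAt.norm
    have hc2 : ContinuousAt (fun s => K * √2 *
        (|combDeriv (gapCoeff a) 0 ξ s| + |combDeriv (gapCoeff a) 1 ξ s|)) t :=
      continuousAt_const.mul ((h.hasDerivAt_gapComb ξ ht 0).continuousAt.abs.add
        (h.hasDerivAt_gapComb ξ ht 1).continuousAt.abs)
    have : (𝓝[≠] t ⊓ 𝓟 (Icc 0 T)).NeBot := hacc
    have hle : 𝓝[≠] t ⊓ 𝓟 (Icc 0 T) ≤ 𝓝 t := inf_le_left.trans nhdsWithin_le_nhds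
    refine le_of_tendsto_of_tendsto (hc1.mono_left hle) (hc2.mono_left hle) ?_
    filter_upwards [hz.filter_mono inf_le_left,
      mem_inf_of_right (mem_principal_self (Icc 0 T))] with s hs hsm
    refine h.norm_shiftCoeff_one_le_of_ne_zero hK hsm ξ ?_
    rw [h.gap_eq_combDeriv ξ hsm] at hs
    exact hs

theorem leviSum_le_variation (h : IsDoubleRootSymbol T a τ) {K K₂ : ℝ} (hK0 : 0 ≤ K) {t : ℝ}
    (ht : t ∈ Icc 0 T) (ξ : Freq n) (h0 : shiftCoeff a 0 t ξ = 0)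
    (h2 : ‖shiftCoeff a 2 t ξ‖ ≤ K₂)
    (h1 : ‖shiftCoeff a 1 t ξ‖ ≤
      K * (|combDeriv (gapCoeff a) 0 ξ t| + |combDeriv (gapCoeff a) 1 ξ t|)) :
    leviSum (gap a t ξ) (shiftCoeff a 0 t ξ) (shiftCoeff a 1 t ξ) (shiftCoeff a 2 t ξ) ≤
      24 * (K₂ + K) + 24 * K *
        (|combDeriv (gapCoeff a) 1 ξ t| / √(1 + combDeriv (gapCoeff a) 0 ξ t ^ 2)) := by
  rw [h0]
  refine (leviSum_le _ _ _).trans ?_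
  rw [h.gap_eq_combDeriv ξ ht]
  change 24 * (_ + _ / (1 + |combDeriv (gapCoeff a) 0 ξ t|)) ≤ _
  set f := combDeriv (gapCoeff a) 0 ξ t
  set f' := combDeriv (gapCoeff a) 1 ξ t
  have hf := abs_nonneg f
  have hf' := abs_nonneg f'
  have hs : √(1 + f ^ 2) ≤ 1 + |f| := by
    rw [Real.sqrt_le_left (by positivity), ← sq_abs f]
    nlinarith
  have e1 : ‖shiftCoeff a 1 t ξ‖ / (1 + |f|) ≤ K * (1 + |f'| / √(1 + f ^ 2)) := by
    calc _ ≤ K * (|f| + |f'|) / (1 + |f|) := by gcongr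
      _ = K * (|f| / (1 + |f|) + |f'| / (1 + |f|)) := by ring
      _ ≤ K * (1 + |f'| / √(1 + f ^ 2)) := by
        gcongr
        rw [div_le_one (by positivity)]
        linarith
  linarith

theorem leviM_of_vanishes_of_bound (h : IsDoubleRootSymbol T a τ)
    {lam : Fin 3 → ℝ → Freq n → ℂ}
    (hlam : ∀ t ∈ Icc 0 T, ∀ ξ : Freq n, IsRootList (auxL a t ξ) (fun j => lam j t ξ))
    (hM : McheckVanishes T a τ) (hQ : QBound T a τ) : LeviM T a lam := by
  rw [h.leviM_iff hlam]
  rw [h.mcheckVanishes_iff] at hM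
  obtain ⟨K, hK0, hK⟩ := hQ
  obtain ⟨K₂, hK₂0, hK₂⟩ := h.exists_norm_shiftCoeff_two_le
  have hd : ∀ i, AnalyticOnNhd ℝ (gapCoeff a i) (Icc 0 T) := fun i =>
    h.analyticOnNhd_gap (EuclideanSpace.single i 1)
  obtain ⟨N, hN0, hN⟩ := exists_uniform_variation_bound h.pos hd
  have hb : ∀ i, ∃ D, ∀ t ∈ Icc 0 T, |gapCoeff a i t| ≤ D := fun i =>
    isCompact_Icc.exists_bound_of_continuousOn (hd i).continuousOn
  choose D hD using hb
  obtain ⟨D₀, hD₀0, hD₀⟩ : ∃ D₀ : ℝ, 0 ≤ D₀ ∧ ∀ i, D i ≤ D₀ :=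
    ⟨∑ i, |D i|, Finset.sum_nonneg fun _ _ => abs_nonneg _, fun i => (le_abs_self _).trans
      (Finset.single_le_sum (f := fun i => |D i|) (fun _ _ => abs_nonneg _) (Finset.mem_univ i))⟩
  have hK1 : ∀ t ∈ Icc 0 T, ∀ ξ : Freq n, ‖shiftCoeff a 1 t ξ‖ ≤
      K * √2 * (|combDeriv (gapCoeff a) 0 ξ t| + |combDeriv (gapCoeff a) 1 ξ t|) :=
    fun t ht ξ => h.norm_shiftCoeff_one_le hK0 (fun t ht ξ d hd => by
      rw [← (eval_quotQ (h.roots t ht ξ) (h.double t ht ξ)).1]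
      exact hK 0 (Or.inl rfl) t ht ξ d hd) ht ξ
  intro R hR
  have hlogR : 0 < Real.log (1 + R) := Real.log_pos (by linarith)
  set A := 24 * (K₂ + K * √2) * T with hA
  have hT := h.pos
  have hA0 : 0 < A := by positivity
  have hlD : 0 ≤ Real.log (1 + 2 * (n * D₀)) := Real.log_nonneg (by
    have : 0 ≤ 2 * (n * D₀) := by positivity
    linarith)
  refine ⟨(A + 24 * (K * √2) * N * Real.log (1 + 2 * (n * D₀))) / Real.log (1 + R) +
    24 * (K * √2) * N, by positivity, fun ξ hξ => ?_⟩
  have hv := hN ξ (n * D₀ * ‖ξ‖) fun t ht =>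
    abs_combDeriv_zero_le (fun i => (hD i t ht).trans (hD₀ i)) ξ
  have hvint : IntervalIntegrable (fun t => |combDeriv (gapCoeff a) 1 ξ t| /
      √(1 + combDeriv (gapCoeff a) 0 ξ t ^ 2)) volume 0 T :=
    intervalIntegrable_abs_deriv_div (g := fun k => combDeriv (gapCoeff a) k ξ) hT.le
      fun k x hx => h.hasDerivAt_gapComb ξ hx k
  calc _ ≤ ∫ t in (0 : ℝ)..T, (24 * (K₂ + K * √2) + 24 * (K * √2) *
        (|combDeriv (gapCoeff a) 1 ξ t| / √(1 + combDeriv (gapCoeff a) 0 ξ t ^ 2))) :=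
        intervalIntegral.integral_mono_on hT.le (h.intervalIntegrable_leviSum ξ)
          (intervalIntegrable_const.add (hvint.const_mul _)) fun t ht =>
          h.leviSum_le_variation (by positivity) ht ξ (hM t ht ξ) (hK₂ t ht ξ) (hK1 t ht ξ)
    _ = A + 24 * (K * √2) * ∫ t in (0 : ℝ)..T,
        (|combDeriv (gapCoeff a) 1 ξ t| / √(1 + combDeriv (gapCoeff a) 0 ξ t ^ 2)) := by
      rw [intervalIntegral.integral_add intervalIntegrable_const (hvint.const_mul _),
        intervalIntegral.integral_const, intervalIntegral.integral_const_mul, hA]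
      simp only [sub_zero, smul_eq_mul]
      ring
    _ ≤ A + 24 * (K * √2) * (N * Real.log (1 + 2 * (n * D₀ * ‖ξ‖))) := by gcongr
    _ = A + 24 * (K * √2) * N * Real.log (1 + 2 * (n * D₀) * ‖ξ‖) := by ring_nf
    _ ≤ _ := add_log_le_log hA0.le (by positivity) (by positivity) hR hξ

end IsDoubleRootSymbol

end Sufficiency

section Necessity

theorem exists_lt_of_log_bound {c K : ℝ} (hc : 0 < c) :
    ∃ y : ℝ, 1 ≤ y ∧ K * Real.log (1 + y) < c * y := by
  have h : Tendsto (fun y : ℝ => Real.log (1 + y) / (1 + y)) atTop (𝓝 0) := by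
    have h0 := Real.isLittleO_log_id_atTop.tendsto_div_nhds_zero
    exact h0.comp (tendsto_atTop_add_const_left atTop 1 tendsto_id)
  have h1 : Tendsto (fun y : ℝ => |K| * (Real.log (1 + y) / (1 + y))) atTop (𝓝 0) := by
    simpa using h.const_mul |K|
  obtain ⟨y, hy, hy1⟩ := ((h1.eventually_lt_const (half_pos hc)).and
    (eventually_ge_atTop 1)).exists
  refine ⟨y, hy1, ?_⟩
  have hlog : 0 ≤ Real.log (1 + y) := Real.log_nonneg (by linarith)
  rw [← mul_div_assoc, div_lt_iff₀ (by linarith)] at hy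
  have := mul_le_mul_of_nonneg_right (le_abs_self K) hlog
  nlinarith

theorem exists_subinterval {T t₀ h : ℝ} (ht₀ : t₀ ∈ Icc 0 T) (h0 : 0 < h) (hT : h ≤ T / 2) :
    ∃ α β, 0 ≤ α ∧ β ≤ T ∧ β - α = h / 2 ∧ ∀ t ∈ Icc α β, h / 2 ≤ |t - t₀| ∧ |t - t₀| ≤ h := by
  rcases le_total t₀ (T / 2) with hh | hh
  · refine ⟨t₀ + h / 2, t₀ + h, by linarith [ht₀.1], by linarith, by ring, fun t ht => ?_⟩
    rw [abs_of_nonneg (by linarith [ht.1])]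
    exact ⟨by linarith [ht.1], by linarith [ht.2]⟩
  · refine ⟨t₀ - h, t₀ - h / 2, by linarith, by linarith [ht₀.2], by ring, fun t ht => ?_⟩
    rw [abs_of_nonpos (by linarith [ht.2])]
    exact ⟨by linarith [ht.2], by linarith [ht.1]⟩

theorem mul_length_le_integral {F : ℝ → ℝ} {T α β c : ℝ} (hF : IntervalIntegrable F volume 0 T)
    (h0 : ∀ t, 0 ≤ F t) (hα : 0 ≤ α) (hαβ : α ≤ β) (hβ : β ≤ T)
    (hc : ∀ t ∈ Icc α β, c ≤ F t) : c * (β - α) ≤ ∫ t in (0 : ℝ)..T, F t := by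
  have hsub : uIcc α β ⊆ uIcc 0 T := by
    rw [uIcc_of_le hαβ, uIcc_of_le (hα.trans (hαβ.trans hβ))]
    exact Icc_subset_Icc hα hβ
  calc c * (β - α) = ∫ _ in α..β, c := by
        rw [intervalIntegral.integral_const, smul_eq_mul, mul_comm]
    _ ≤ ∫ t in α..β, F t := intervalIntegral.integral_mono_on hαβ intervalIntegrable_const
        (hF.mono_set hsub) hc
    _ ≤ ∫ t in (0 : ℝ)..T, F t := intervalIntegral.integral_mono_interval hα hαβ hβ
        (Eventually.of_forall h0) hF

variable {T : ℝ} {d : ℝ → ℝ} {b : ℝ → ℂ}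

theorem intervalIntegrable_norm_div (hT : 0 < T) (hd : ContinuousOn d (Icc 0 T))
    (hb : ContinuousOn b (Icc 0 T)) {x : ℝ} (hx : 0 ≤ x) (C : ℝ) :
    IntervalIntegrable (fun t => C * ‖b t‖ / (1 + x * |d t|)) volume 0 T := by
  apply ContinuousOn.intervalIntegrable
  rw [uIcc_of_le hT.le]
  refine ContinuousOn.div (by fun_prop) (by fun_prop) fun t _ => ?_
  positivity

theorem eq_zero_of_log_bound (hT : 0 < T) (hd : ContinuousOn d (Icc 0 T))
    (hb : ContinuousOn b (Icc 0 T)) {K : ℝ} (hK : ∀ x : ℝ, 1 ≤ x →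
      ∫ t in (0 : ℝ)..T, x ^ 2 * ‖b t‖ / (1 + x * |d t|) ≤ K * Real.log (1 + x)) :
    ∀ t ∈ Icc 0 T, b t = 0 := by
  intro t₀ ht₀
  by_contra hne
  have hpos : 0 < ‖b t₀‖ := norm_pos_iff.2 hne
  obtain ⟨D, hD⟩ := isCompact_Icc.exists_bound_of_continuousOn hd
  have hD0 : 0 ≤ D := (norm_nonneg _).trans (hD t₀ ht₀)
  obtain ⟨δ, hδ, hball⟩ := Metric.continuousOn_iff.1 hb.norm t₀ ht₀ (‖b t₀‖ / 2) (by positivity)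
  set h := min (δ / 2) (T / 2) with hh
  have h0 : 0 < h := by positivity
  obtain ⟨α, β, hα, hβ, hlen, hI⟩ := exists_subinterval ht₀ h0 (min_le_right _ _)
  obtain ⟨x, hx, hlt⟩ := exists_lt_of_log_bound (K := K)
    (c := ‖b t₀‖ / 2 / (1 + D) * (h / 2)) (by positivity)
  have hx0 : 0 < x := by linarith
  have hlow := mul_length_le_integral (c := ‖b t₀‖ / 2 / (1 + D) * x)
    (intervalIntegrable_norm_div hT hd hb hx0.le (x ^ 2)) (fun t => by positivity) hα
    (by linarith) hβ fun t ht => by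
      have htI : t ∈ Icc 0 T := ⟨hα.trans ht.1, ht.2.trans hβ⟩
      have h1 := hball t htI (by
        rw [Real.dist_eq]
        linarith [(hI t ht).2, min_le_left (δ / 2) (T / 2)])
      rw [Real.dist_eq, abs_lt] at h1
      have h2 : |d t| ≤ D := hD t htI
      calc ‖b t₀‖ / 2 / (1 + D) * x = x ^ 2 * (‖b t₀‖ / 2) / (x * (1 + D)) := by field_simp
        _ ≤ x ^ 2 * ‖b t‖ / (1 + x * |d t|) := by
          gcongr
          · linarith
          · nlinarith
  have := hK x hx
  rw [hlen] at hlow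
  linarith

/-- The logarithmic bound forces the vanishing order of `b` to be at least that of `d'`. -/
theorem false_of_low_order (hT : 0 < T) (hd : ContinuousOn d (Icc 0 T))
    (hb : ContinuousOn b (Icc 0 T)) {K : ℝ} (hK : ∀ x : ℝ, 1 ≤ x →
      ∫ t in (0 : ℝ)..T, x * ‖b t‖ / (1 + x * |d t|) ≤ K * Real.log (1 + x))
    {t₀ : ℝ} (ht₀ : t₀ ∈ Icc 0 T) {u : ℝ → ℝ} {v : ℝ → ℂ} {k p : ℕ} (hpk : p + 2 ≤ k)
    (hu : ContinuousAt u t₀) (hv : ContinuousAt v t₀) (hv0 : v t₀ ≠ 0)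
    (hdu : ∀ᶠ t in 𝓝 t₀, d t = (t - t₀) ^ k * u t)
    (hbv : ∀ᶠ t in 𝓝 t₀, b t = (t - t₀) ^ p • v t) : False := by
  have hvpos : 0 < ‖v t₀‖ := norm_pos_iff.2 hv0
  have hue : ∀ᶠ t in 𝓝 t₀, |u t| < |u t₀| + 1 :=
    hu.abs.eventually_lt_const (lt_add_one _)
  have hve : ∀ᶠ t in 𝓝 t₀, ‖v t₀‖ / 2 < ‖v t‖ :=
    hv.norm.eventually_const_lt (half_lt_self hvpos)
  obtain ⟨δ, hδ, hball⟩ := Metric.eventually_nhds_iff.1 (hdu.and (hbv.and (hue.and hve)))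
  set ε := min (δ / 2) (T / 2) with hεdef
  have hε : 0 < ε := by positivity
  set U := |u t₀| + 1
  have hU : 0 < U := by positivity
  set c := (ε / 2) ^ (p + 1) * (‖v t₀‖ / 2) / (1 + ε ^ k * U) with hc
  obtain ⟨y, hy, hlt⟩ := exists_lt_of_log_bound (K := |K| * k) (c := c) (by positivity)
  have hy0 : 0 < y := by linarith
  have hεy : ε / y ≤ ε := div_le_self hε.le hy
  have hyk : 1 ≤ y ^ k := one_le_pow₀ hy
  obtain ⟨α, β, hα, hβ, hlen, hI⟩ := exists_subinterval ht₀ (h := ε / y) (by positivity)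
    (hεy.trans (min_le_right _ _))
  have hlow := mul_length_le_integral
    (c := y ^ k * ((ε / y / 2) ^ p * (‖v t₀‖ / 2)) / (1 + ε ^ k * U))
    (intervalIntegrable_norm_div hT hd hb (by positivity : 0 ≤ y ^ k) (y ^ k))
    (fun t => by positivity) hα (by rw [← sub_nonneg, hlen]; positivity) hβ fun t ht => by
      obtain ⟨hl, hr⟩ := hI t ht
      obtain ⟨e1, e2, e3, e4⟩ := hball (y := t) (by
        rw [Real.dist_eq]
        linarith [min_le_left (δ / 2) (T / 2)])
      rw [e1, e2, norm_smul, abs_mul, norm_pow, abs_pow, Real.norm_eq_abs]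
      have hden : y ^ k * (|t - t₀| ^ k * |u t|) ≤ ε ^ k * U := by
        calc _ ≤ y ^ k * ((ε / y) ^ k * U) := by gcongr
          _ = ε ^ k * U := by rw [div_pow]; field_simp
      gcongr
  have hup := hK (y ^ k) hyk
  have hlog : Real.log (1 + y ^ k) ≤ k * Real.log (1 + y) := by
    rw [← Real.log_pow]
    refine Real.log_le_log (by positivity) ?_
    have hk0 : k ≠ 0 := by omega
    simpa using pow_add_pow_le (zero_le_one' ℝ) hy0.le hk0
  have hcy : c * y ≤ y ^ k * ((ε / y / 2) ^ p * (‖v t₀‖ / 2)) / (1 + ε ^ k * U) * (β - α) := by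
    have hyp : y * y ^ (p + 1) ≤ y ^ k := by
      rw [← pow_succ']
      exact pow_le_pow_right₀ hy (by omega)
    rw [hlen]
    have : y ≤ y ^ k / y ^ (p + 1) := by rwa [le_div_iff₀ (by positivity)]
    calc c * y ≤ c * (y ^ k / y ^ (p + 1)) := by gcongr
      _ = _ := by
        rw [hc]
        simp only [div_pow]
        field_simp
        ring
  have hlogy : 0 ≤ Real.log (1 + y) := Real.log_nonneg (by linarith)
  have hlogk : 0 ≤ Real.log (1 + y ^ k) := Real.log_nonneg (by linarith)
  have : K * Real.log (1 + y ^ k) ≤ |K| * (k * Real.log (1 + y)) :=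
    mul_le_mul (le_abs_self K) hlog hlogk (abs_nonneg K)
  linarith

theorem eventually_bound_of_log_bound (hT : 0 < T) (hd : AnalyticOnNhd ℝ d (Icc 0 T))
    (hb : AnalyticOnNhd ℝ b (Icc 0 T)) {K : ℝ} (hK : ∀ x : ℝ, 1 ≤ x →
      ∫ t in (0 : ℝ)..T, x * ‖b t‖ / (1 + x * |d t|) ≤ K * Real.log (1 + x))
    {t₀ : ℝ} (ht₀ : t₀ ∈ Icc 0 T) (hord : analyticOrderAt d t₀ ≠ ⊤) :
    ∃ C : ℝ, 0 ≤ C ∧ ∀ᶠ t in 𝓝 t₀, ‖b t‖ ≤ C * (|d t| + |deriv d t|) := by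
  have hdt := hd t₀ ht₀
  have hbt := hb t₀ ht₀
  by_cases hd0 : d t₀ = 0
  · obtain ⟨k, hk⟩ : ∃ k, analyticOrderNatAt d t₀ = k + 1 := by
      refine Nat.exists_eq_succ_of_ne_zero fun h0 => ?_
      have := Nat.cast_analyticOrderNatAt hord
      rw [h0] at this
      exact hdt.analyticOrderAt_eq_zero.1 this.symm hd0
    have hk' : analyticOrderAt d t₀ = (k + 1 : ℕ) := by
      rw [← Nat.cast_analyticOrderNatAt hord, hk]
    obtain ⟨u, hu, hu0, hdu⟩ := hdt.analyticOrderAt_eq_natCast.1 hk'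
    have hderiv : analyticOrderAt (deriv d) t₀ = k := by
      rw [analyticOrderAt_eq_nat_iff_iteratedDeriv_eq_zero hdt] at hk'
      rw [analyticOrderAt_eq_nat_iff_iteratedDeriv_eq_zero hdt.deriv]
      simp only [← iteratedDeriv_succ']
      exact ⟨fun i hi => hk'.1 (i + 1) (by omega), hk'.2⟩
    obtain ⟨w, hw, hw0, hdw⟩ := hdt.deriv.analyticOrderAt_eq_natCast.1 hderiv
    by_cases hbo : (k : ℕ∞) ≤ analyticOrderAt b t₀
    · obtain ⟨g, hg, hbg⟩ := (natCast_le_analyticOrderAt hbt).1 hbo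
      have hwpos : 0 < |w t₀| := abs_pos.2 hw0
      refine ⟨(‖g t₀‖ + 1) / (|w t₀| / 2), by positivity, ?_⟩
      filter_upwards [hbg, hdw, hg.continuousAt.norm.eventually_lt_const (lt_add_one _),
        hw.continuousAt.abs.eventually_const_lt (half_lt_self hwpos)] with t h1 h2 h3 h4
      rw [h1, h2, norm_smul, norm_pow, Real.norm_eq_abs, smul_eq_mul, abs_mul, abs_pow]
      calc |t - t₀| ^ k * ‖g t‖ ≤ |t - t₀| ^ k * (‖g t₀‖ + 1) := by gcongr
        _ = (‖g t₀‖ + 1) / (|w t₀| / 2) * (|t - t₀| ^ k * (|w t₀| / 2)) := by field_simp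
        _ ≤ (‖g t₀‖ + 1) / (|w t₀| / 2) * (|t - t₀| ^ k * |w t|) := by gcongr
        _ ≤ _ := by
          gcongr
          exact le_add_of_nonneg_left (abs_nonneg _)
    · exfalso
      have hbT : analyticOrderAt b t₀ ≠ ⊤ := fun h => hbo (h ▸ le_top)
      obtain ⟨v, hv, hv0, hbv⟩ := hbt.analyticOrderAt_ne_top.1 hbT
      rw [← Nat.cast_analyticOrderNatAt hbT, Nat.cast_le, not_le] at hbo
      exact false_of_low_order hT hd.continuousOn hb.continuousOn hK ht₀ (by omega)
        hu.continuousAt hv.continuousAt hv0 hdu hbv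
  · have hpos : 0 < |d t₀| := abs_pos.2 hd0
    refine ⟨(‖b t₀‖ + 1) / (|d t₀| / 2), by positivity, ?_⟩
    filter_upwards [hbt.continuousAt.norm.eventually_lt_const (lt_add_one _),
      hdt.continuousAt.abs.eventually_const_lt (half_lt_self hpos)] with t h1 h2
    calc ‖b t‖ ≤ ‖b t₀‖ + 1 := h1.le
      _ = (‖b t₀‖ + 1) / (|d t₀| / 2) * (|d t₀| / 2) := by field_simp
      _ ≤ _ := by
        gcongr
        exact h2.le.trans (le_add_of_nonneg_right (abs_nonneg _))

theorem bound_of_log_bound (hT : 0 < T) (hd : AnalyticOnNhd ℝ d (Icc 0 T))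
    (hb : AnalyticOnNhd ℝ b (Icc 0 T)) {K : ℝ} (hK : ∀ x : ℝ, 1 ≤ x →
      ∫ t in (0 : ℝ)..T, x * ‖b t‖ / (1 + x * |d t|) ≤ K * Real.log (1 + x))
    (hne : ∃ t ∈ Icc 0 T, d t ≠ 0) :
    ∃ C : ℝ, 0 ≤ C ∧ ∀ t ∈ Icc 0 T, ‖b t‖ ≤ C * (|d t| + |deriv d t|) := by
  refine isCompact_Icc.induction_on
    (p := fun s => ∃ C : ℝ, 0 ≤ C ∧ ∀ t ∈ s, ‖b t‖ ≤ C * (|d t| + |deriv d t|))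
    ⟨0, le_rfl, by simp⟩ (fun s s' hs ⟨C, hC, h⟩ => ⟨C, hC, fun t ht => h t (hs ht)⟩) ?_ ?_
  · rintro s s' ⟨C, hC, h⟩ ⟨C', hC', h'⟩
    refine ⟨C + C', by positivity, ?_⟩
    rintro t (ht | ht)
    · refine (h t ht).trans ?_
      gcongr
      linarith
    · refine (h' t ht).trans ?_
      gcongr
      linarith
  · intro t₀ ht₀
    have hord : analyticOrderAt d t₀ ≠ ⊤ := by
      intro htop
      obtain ⟨t, ht, hdt⟩ := hne
      exact hdt (hd.eqOn_zero_of_preconnected_of_eventuallyEq_zero isPreconnected_Icc ht₀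
        (analyticOrderAt_eq_top.1 htop) ht)
    obtain ⟨C, hC, h⟩ := eventually_bound_of_log_bound hT hd hb hK ht₀ hord
    exact ⟨_, mem_nhdsWithin_of_mem_nhds h, C, hC, fun t ht => ht⟩

/-- Any one-sided or two-sided derivative of `|f|` has absolute value `|f'|`. -/
theorem abs_hasDerivWithinAt_abs {f F : ℝ → ℝ} {c f' e t : ℝ} {s : Set ℝ}
    (hF : ∀ x ∈ s, F x = c * |f x|) (hc : 0 ≤ c) (ht : t ∈ s) (hs : AccPt t (𝓟 s))
    (hf : HasDerivAt f f' t) (he : HasDerivWithinAt F e s t) : |e| = c * |f'| := by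
  have : (𝓝[s \ {t}] t).NeBot := accPt_principal_iff_nhdsWithin.1 hs
  have h1 := (hasDerivWithinAt_iff_tendsto_slope.1 he).abs
  have h2 := ((hasDerivWithinAt_iff_tendsto_slope.1 (hf.hasDerivWithinAt (s := s))).abs).const_mul c
  refine tendsto_nhds_unique (h1.congr' ?_) h2
  have hsd : ∀ᶠ x in 𝓝[s \ {t}] t, x ∈ s := by
    filter_upwards [self_mem_nhdsWithin] with x hx using hx.1
  have hsign : ∀ᶠ x in 𝓝[s \ {t}] t, 0 ≤ f x * f t := by
    by_cases h0 : f t = 0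
    · simp [h0]
    · have : ∀ᶠ x in 𝓝 t, 0 < f x * f t :=
        (hf.continuousAt.mul continuousAt_const).eventually_const_lt (mul_self_pos.2 h0)
      exact (this.filter_mono nhdsWithin_le_nhds).mono fun x hx => hx.le
  filter_upwards [hsd, hsign] with x hx hx0
  have hdiff : |(|f x| - |f t|)| = |f x - f t| := by
    rcases le_total 0 (f x) with h | h <;> rcases le_total 0 (f t) with h' | h'
    · rw [abs_of_nonneg h, abs_of_nonneg h']
    · rcases (mul_nonneg_iff.1 hx0) with ⟨_, h3⟩ | ⟨h3, _⟩
      · rw [le_antisymm h' h3]; simp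
      · rw [le_antisymm h3 h]; simp
    · rcases (mul_nonneg_iff.1 hx0) with ⟨h3, _⟩ | ⟨_, h3⟩
      · rw [le_antisymm h h3]; simp
      · rw [le_antisymm h3 h']; simp
    · rw [abs_of_nonpos h, abs_of_nonpos h', ← abs_neg]
      congr 1
      ring
  rw [slope_def_field, slope_def_field, hF x hx, hF t ht, ← mul_sub, abs_div, abs_mul,
    abs_of_nonneg hc, hdiff, abs_div, mul_div_assoc]

section OneDim

variable {a : Coeffs 1} {τ : Fin 3 → ℝ → Freq 1 → ℝ}

theorem eq_smul_single (ξ : Freq 1) : ξ = ξ 0 • EuclideanSpace.single 0 (1 : ℝ) := by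
  ext i
  fin_cases i
  simp

namespace IsDoubleRootSymbol

theorem exists_log_bound (h : IsDoubleRootSymbol T a τ) {lam : Fin 3 → ℝ → Freq 1 → ℂ}
    (hlam : ∀ t ∈ Icc 0 T, ∀ ξ : Freq 1, IsRootList (auxL a t ξ) (fun j => lam j t ξ))
    (hL : LeviM T a lam) : ∃ K : ℝ, ∀ x : ℝ, 1 ≤ x →
      (∫ t in (0 : ℝ)..T, x ^ 2 * ‖shiftCoeff a 0 t (EuclideanSpace.single 0 1)‖ /
        (1 + x * |gap a t (EuclideanSpace.single 0 1)|) ≤ K * Real.log (1 + x)) ∧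
      ∫ t in (0 : ℝ)..T, x * ‖shiftCoeff a 1 t (EuclideanSpace.single 0 1)‖ /
        (1 + x * |gap a t (EuclideanSpace.single 0 1)|) ≤ K * Real.log (1 + x) := by
  rw [h.leviM_iff hlam] at hL
  obtain ⟨K, hK0, hK⟩ := hL 1 one_pos
  set e : Freq 1 := EuclideanSpace.single 0 1 with he
  have hgap := (h.analyticOnNhd_gap e).continuousOn
  refine ⟨7 * K, fun x hx => ?_⟩
  have hx0 : 0 < x := by linarith
  have hnorm : ‖x • e‖ = x := by
    rw [norm_smul, he, PiLp.norm_single, Real.norm_of_nonneg hx0.le]; simp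
  have hKx := hK (x • e) (by rw [hnorm]; exact hx)
  have hint := h.intervalIntegrable_leviSum (x • e)
  rw [hnorm] at hKx
  have h7 : ∫ t in (0 : ℝ)..T, 7 * leviSum (gap a t (x • e)) (shiftCoeff a 0 t (x • e))
      (shiftCoeff a 1 t (x • e)) (shiftCoeff a 2 t (x • e)) ≤ 7 * K * Real.log (1 + x) := by
    rw [intervalIntegral.integral_const_mul]
    linarith
  have hpt : ∀ t, x ^ 2 * ‖shiftCoeff a 0 t e‖ / (1 + x * |gap a t e|) ≤
        7 * leviSum (gap a t (x • e)) (shiftCoeff a 0 t (x • e))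
          (shiftCoeff a 1 t (x • e)) (shiftCoeff a 2 t (x • e)) ∧
      x * ‖shiftCoeff a 1 t e‖ / (1 + x * |gap a t e|) ≤
        7 * leviSum (gap a t (x • e)) (shiftCoeff a 0 t (x • e))
          (shiftCoeff a 1 t (x • e)) (shiftCoeff a 2 t (x • e)) := by
    intro t
    have hpos : 0 < 1 + x * |gap a t e| := by positivity
    obtain ⟨l0, l1⟩ := norm_le_leviSum (gap a t (x • e)) (shiftCoeff a 0 t (x • e))
      (shiftCoeff a 1 t (x • e)) (shiftCoeff a 2 t (x • e))
    set S := leviSum (gap a t (x • e)) (shiftCoeff a 0 t (x • e))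
      (shiftCoeff a 1 t (x • e)) (shiftCoeff a 2 t (x • e))
    rw [gap_smul, abs_mul, abs_of_pos hx0, shiftCoeff_smul 0 (by norm_num), norm_mul, norm_pow,
      Complex.norm_real, Real.norm_of_nonneg hx0.le] at l0
    rw [gap_smul, abs_mul, abs_of_pos hx0, shiftCoeff_smul 1 (by norm_num), norm_mul, norm_pow,
      Complex.norm_real, Real.norm_of_nonneg hx0.le] at l1
    norm_num at l0 l1
    constructor
    · rw [div_le_iff₀ hpos]; linarith
    · rw [div_le_iff₀ hpos]; linarith
  constructor
  · exact (intervalIntegral.integral_mono_on h.pos.le (intervalIntegrable_norm_div h.pos hgap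
      (h.analyticOnNhd_shiftCoeff 0 (by norm_num) e).continuousOn hx0.le _) (hint.const_mul 7)
      fun t _ => (hpt t).1).trans h7
  · exact (intervalIntegral.integral_mono_on h.pos.le (intervalIntegrable_norm_div h.pos hgap
      (h.analyticOnNhd_shiftCoeff 1 (by norm_num) e).continuousOn hx0.le _) (hint.const_mul 7)
      fun t _ => (hpt t).2).trans h7

theorem vanishes_and_bound_of_leviM (h : IsDoubleRootSymbol T a τ)
    {lam : Fin 3 → ℝ → Freq 1 → ℂ}
    (hlam : ∀ t ∈ Icc 0 T, ∀ ξ : Freq 1, IsRootList (auxL a t ξ) (fun j => lam j t ξ))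
    (h13 : ∃ t ∈ Icc 0 T, ∃ ξ : Freq 1, τ 2 t ξ ≠ τ 0 t ξ)
    (hL : LeviM T a lam) : McheckVanishes T a τ ∧ QBound T a τ := by
  obtain ⟨K, hK⟩ := h.exists_log_bound hlam hL
  set e : Freq 1 := EuclideanSpace.single 0 1 with he
  have hgap := h.analyticOnNhd_gap e
  have hb0 := h.analyticOnNhd_shiftCoeff 0 (by norm_num) e
  have hb1 := h.analyticOnNhd_shiftCoeff 1 (by norm_num) e
  have hgne : ∃ t ∈ Icc 0 T, gap a t e ≠ 0 := by
    obtain ⟨t, ht, ξ, hne⟩ := h13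
    refine ⟨t, ht, fun h0 => hne ?_⟩
    have := gap_eq (h.roots t ht ξ) (h.double t ht ξ)
    rw [eq_smul_single ξ, gap_smul, ← he, h0, mul_zero] at this
    rw [eq_smul_single ξ, ← he]
    linarith
  constructor
  · rw [h.mcheckVanishes_iff]
    intro t ht ξ
    rw [eq_smul_single ξ, shiftCoeff_smul 0 (by norm_num), ← he,
      eq_zero_of_log_bound h.pos hgap.continuousOn hb0.continuousOn (fun x hx => (hK x hx).1) t ht,
      mul_zero]
  · obtain ⟨C, hC, hbd⟩ := bound_of_log_bound h.pos hgap hb1 (fun x hx => (hK x hx).2) hgne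
    obtain ⟨K₂, hK₂0, hK₂⟩ := h.exists_norm_shiftCoeff_two_le
    refine ⟨C + K₂, by positivity, fun j hj t ht ξ d hd => ?_⟩
    set x := ξ 0 with hx
    have hxe : ξ = x • e := eq_smul_single ξ
    have hacc : AccPt t (𝓟 (Icc 0 T)) := isPreconnected_Icc.preperfect_of_nontrivial
      ⟨0, left_mem_Icc.2 h.pos.le, T, right_mem_Icc.2 h.pos.le, h.pos.ne⟩ t ht
    have hdisc : ∀ s ∈ Icc 0 T, √(disc1 τ s ξ) = √2 * |x| * |gap a s e| := by
      intro s hs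
      rw [disc1_eq (h.roots s hs ξ) (h.double s hs ξ), hxe, gap_smul, abs_mul, mul_assoc]
    have hdabs : |d| = √2 * |x| * |deriv (fun s => gap a s e) t| :=
      abs_hasDerivWithinAt_abs hdisc (by positivity) ht hacc
        (hgap t ht).differentiableAt.hasDerivAt hd
    have hs2 : 1 ≤ √2 := Real.one_le_sqrt.2 (by norm_num)
    have hm1 : ‖shiftCoeff a 1 t ξ‖ ≤ C * (√(disc1 τ t ξ) + |d|) := by
      have e1 : ‖shiftCoeff a 1 t ξ‖ = |x| * ‖shiftCoeff a 1 t e‖ := by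
        rw [hxe, shiftCoeff_smul 1 (by norm_num), norm_mul]
        simp
      rw [e1, hdisc t ht, hdabs]
      calc |x| * ‖shiftCoeff a 1 t e‖
          ≤ |x| * (C * (|gap a t e| + |deriv (fun s => gap a s e) t|)) := by
            gcongr
            exact hbd t ht
        _ = 1 * (|x| * (C * (|gap a t e| + |deriv (fun s => gap a s e) t|))) := (one_mul _).symm
        _ ≤ √2 * (|x| * (C * (|gap a t e| + |deriv (fun s => gap a s e) t|))) := by gcongr
        _ = _ := by ring
    have hm2 : ‖shiftCoeff a 2 t ξ * gap a t ξ‖ ≤ K₂ * √(disc1 τ t ξ) := by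
      rw [disc1_eq (h.roots t ht ξ) (h.double t ht ξ), norm_mul, Complex.norm_real,
        Real.norm_eq_abs]
      refine mul_le_mul (hK₂ t ht ξ) ?_ (abs_nonneg _) hK₂0.le
      exact le_mul_of_one_le_left (abs_nonneg _) hs2
    have hdn := abs_nonneg d
    have hsn := Real.sqrt_nonneg (disc1 τ t ξ)
    obtain ⟨q0, q2⟩ := eval_quotQ (h.roots t ht ξ) (h.double t ht ξ)
    rcases hj with rfl | rfl
    · rw [q0]
      refine hm1.trans ?_
      gcongr
      linarith
    · rw [q2]
      refine (norm_add_le _ _).trans ((add_le_add hm1 hm2).trans ?_)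
      nlinarith [mul_nonneg hK₂0.le hdn]

end IsDoubleRootSymbol

end OneDim

end Necessity

end ThirdOrder

theorem mainTheorem11 {n : ℕ} {T : ℝ} (hT : 0 < T)
    (a : ThirdOrder.Coeffs n)
    (ha : ∀ (j : ℕ) (α : Fin n → ℕ), j < 3 → (j + ∑ i, α i = 2 ∨ j + ∑ i, α i = 3) →
      AnalyticOnNhd ℝ (a j α) (Set.Icc 0 T))
    (τ : Fin 3 → ℝ → ThirdOrder.Freq n → ℝ)
    (hτ : ∀ t ∈ Set.Icc 0 T, ∀ ξ : ThirdOrder.Freq n,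
      ThirdOrder.IsRootList (ThirdOrder.symL a t ξ) (fun j => (τ j t ξ : ℂ)))
    (hτ12 : ∀ t ∈ Set.Icc 0 T, ∀ ξ : ThirdOrder.Freq n, τ 0 t ξ = τ 1 t ξ)
    (hτ13 : ∃ t ∈ Set.Icc 0 T, ∃ ξ : ThirdOrder.Freq n, τ 2 t ξ ≠ τ 0 t ξ)
    (lam : Fin 3 → ℝ → ThirdOrder.Freq n → ℂ)
    (hlam : ∀ t ∈ Set.Icc 0 T, ∀ ξ : ThirdOrder.Freq n,
      ThirdOrder.IsRootList (ThirdOrder.auxL a t ξ) (fun j => lam j t ξ)) :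
    (ThirdOrder.McheckVanishes T a τ ∧ ThirdOrder.QBound T a τ → ThirdOrder.LeviM T a lam) ∧
    (n = 1 → ThirdOrder.LeviM T a lam →
      ThirdOrder.McheckVanishes T a τ ∧ ThirdOrder.QBound T a τ) := by
  have h : ThirdOrder.IsDoubleRootSymbol T a τ := ⟨hT, ha, hτ, hτ12⟩
  refine ⟨fun ⟨hM, hQ⟩ => h.leviM_of_vanishes_of_bound hlam hM hQ, ?_⟩
  rintro rfl hL
  exact h.vanishes_and_bound_of_leviM hlam hτ13 hL
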